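/- All algebras considered are algebras in the usual sense of universal algebra; $\mathbb{I}$ and $\mathbb{S}$ denote closure under isomorphic copies and subalgebras, a variety is a class of algebras of the same language closed under homomorphic images, subalgebras and direct products, and $\mathbb{V}(\mathbf{C})$ is the least variety containing the algebra $\mathbf{C}$. For a natural number $n$ let $\mathbf{A}_n$ be the Heyting algebra (in the language $\wedge,\vee,\to,0,1$, with $\lnot a = a\to 0$) whose lattice reduct is obtained by adding a new maximum $1$ to the powerset lattice $\langle \mathcal{P}(\{1,\dots,n\});\cap,\cup\rangle$; its implication is $a\to b=1$ if $a\le b$, $\ 1\to b=b$, and $a\to b=(\{1,\dots,n\}\setminus a)\cup b$ if $a,b$ are subsets of $\{1,\dots,n\}$ with $a\not\le b$. Let $n\ge 3$. Put $d(t)=t\vee\lnot t$. For $1\le m\le n-1$ let $s_m=z_1^m\vee\dots\vee z_{n+1}^m$ and let $\psi_{m,n}(x,y,z_1^m,\dots,z_{n+1}^m)$ be the conjunction of the equations $d(x)\approx d(z_i^m)$ for $1\le i\le n+1$, the equation $d(x)\vee\lnot\lnot(x\vee s_m)\approx y$, and the equation $$\Big((s_m\to x)\wedge\bigwedge_{\substack{1\le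 i,j\le m+1\\ i\ne j}}\lnot(z_i^m\wedge z_j^m)\Big)\vee\Big((s_m\to\lnot x)\wedge\bigwedge_{\substack{m+2\le i,j\le n+1\\ i\ne j}}\lnot(z_i^m\wedge z_j^m)\Big)\approx 1 ,$$ where an empty meet is $1$. For $1\le k\le n-1$ let $\varphi_{k,n}(x,y)$ be the primitive positive formula obtained by existentially quantifying all the variables $z_i^m$ and $w_m$ ($1\le m\le k$, $1\le i\le n+1$) in the conjunction of $y\approx w_1\vee\dots\vee w_k$ and of the formulas $\psi_{m,n}(x,w_m,z_1^m,\dots,z_{n+1}^m)$ for $1\le m\le k$. For every $1\le k\le n-1$ the formula $\varphi_{k,n}$ is functional in $\mathbb{V}(\mathbf{A}_n)$ (for every $\mathbf{C}\in\mathbb{V}(\mathbf{A}_n)$ and every $a\in C$ there is at most one $b\in C$ with $\mathbf{C}\vDash\varphi_{k,n}(a,b)$), so that it defines a unary partial function $f_{k,n}^{\mathbf{C}}$ on each $\mathbf{C}\in\mathbb{V}(\mathbf{A}_n)$, and $f_{k,n}^{\mathbf{A}_n}$ is total. Expand the language of Heyting algebras by new unary symbols $\ell_1,\dots,\ell_{n-1}$.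 For $\mathbf{C}\in\mathbb{V}(\mathbf{A}_n)$ on which all the $f_{k,n}^{\mathbf{C}}$ are total, let $\mathbf{C}^+$ be the expansion of $\mathbf{C}$ in which each $\ell_k$ is interpreted as $f_{k,n}^{\mathbf{C}}$. Let $\mathbf{B}_n=\mathbf{A}_n^+$ and $$\mathsf{B}(n)=\mathbb{S}\big(\{\mathbf{C}^+:\mathbf{C}\in\mathbb{V}(\mathbf{A}_n)\text{ and } f_{k,n}^{\mathbf{C}}\text{ is total for all }1\le k\le n-1\}\big).$$ Call an algebra finitely subdirectly irreducible if, whenever it is subdirectly embedded into the direct product of a finite (possibly empty) family of algebras, one of the projections restricts to an isomorphism; in particular, such an algebra is nontrivial. Let $\mathsf{B}(n)_{\mathrm{FSI}}$ be the class of finitely subdirectly irreducible members of $\mathsf{B}(n)$. **Proposition.** For every $n\ge 3$, $$\mathsf{B}(n)=\mathbb{V}(\mathbf{B}_n)\qquad\text{and}\qquad \mathsf{B}(n)_{\mathrm{FSI}}=\mathbb{I}\mathbb{S}(\mathbf{B}_n).$$ Moreover, $\mathsf{B}(n)$ is an arithmetical variety, that is, a variety in which every algebra has a distributive congruence lattice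 and permuting congruences. -/

import Mathlib

open FirstOrder FirstOrder.Language CategoryTheory

universe u

namespace ImplicitOps

/-! ### Universal algebra

An algebra in an algebraic language `L` is a bundled `L.Structure` on a type in `Type u`, and a class
of algebras is a set of such bundles. All languages used below have no relation symbols. -/

section UniversalAlgebra

variable {L : FirstOrder.Language.{0, 0}}

/-- Classes of algebras of the language `L`. -/
abbrev AlgClass (L : FirstOrder.Language.{0, 0}) := Set (Bundled.{u} L.Structure)

/-- The direct product of a family of algebras, with the pointwise operations. -/
instance piStructure {ι : Type*} (N : ι → Type*) [∀ i, L.Structure (N i)] :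
    L.Structure (∀ i, N i) where
  funMap f x := fun i => Structure.funMap f (fun j => x j i)
  RelMap r x := ∀ i, Structure.RelMap r (fun j => x j i)

/-- Isomorphic copies of members of `K`. -/
def opI (K : AlgClass.{u} L) : AlgClass.{u} L :=
  {M | ∃ N ∈ K, Nonempty (M ≃[L] N)}

/-- Homomorphic images of members of `K`. -/
def opH (K : AlgClass.{u} L) : AlgClass.{u} L :=
  {M | ∃ N ∈ K, ∃ h : N →[L] M, Function.Surjective h}

/-- Subalgebras of members of `K` (up to isomorphism, that is, algebras that embed into a member
of `K`). -/
def opS (K : AlgClass.{u} L) : AlgClass.{u} L :=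
  {M | ∃ N ∈ K, Nonempty (M ↪[L] N)}

/-- Direct products of (possibly empty) families of members of `K` (up to isomorphism). -/
def opP (K : AlgClass.{u} L) : AlgClass.{u} L :=
  {M | ∃ (ι : Type u) (N : ι → Bundled.{u} L.Structure),
    (∀ i, N i ∈ K) ∧ Nonempty (M ≃[L] (∀ i, N i))}

/-- A variety is a class closed under homomorphic images, subalgebras and direct products. -/
structure IsVariety (K : AlgClass.{u} L) : Prop where
  closed_H : opH K ⊆ K
  closed_S : opS K ⊆ K
  closed_P : opP K ⊆ K

/-- The variety `𝕍(K)` generated by `K`: the least variety containing `K`. -/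
def varietyGen (K : AlgClass.{u} L) : AlgClass.{u} L :=
  ⋂₀ {V | IsVariety V ∧ K ⊆ V}

/-- A congruence of an algebra: an equivalence relation preserved by all basic operations. -/
structure Congr (L : FirstOrder.Language.{0, 0}) (M : Type u) [L.Structure M] extends Setoid M where
  compat : ∀ {n : ℕ} (f : L.Functions n) (x y : Fin n → M),
    (∀ i, toSetoid (x i) (y i)) → toSetoid (Structure.funMap f x) (Structure.funMap f y)

namespace Congr

variable {M : Type u} [L.Structure M]

theorem toSetoid_injective :
    Function.Injective (Congr.toSetoid : Congr L M → Setoid M) := by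
  rintro ⟨r, hr⟩ ⟨s, hs⟩ h
  cases h
  rfl

/-- Congruences are ordered by inclusion. -/
instance : PartialOrder (Congr L M) :=
  PartialOrder.lift Congr.toSetoid toSetoid_injective

theorem le_iff {θ φ : Congr L M} :
    θ ≤ φ ↔ ∀ a b, θ.toSetoid a b → φ.toSetoid a b := by
  constructor
  · intro h a b hab
    exact h hab
  · intro h a b hab
    exact h a b hab

/-- The intersection of a set of congruences. -/
instance : InfSet (Congr L M) where
  sInf S :=
    { toSetoid := sInf (Congr.toSetoid '' S)
      compat := by
        intro n f x y h
        rintro _ ⟨θ, hθ, rfl⟩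
        exact θ.compat f x y (fun i => h i _ ⟨θ, hθ, rfl⟩) }

theorem isGLB_sInf (S : Set (Congr L M)) : IsGLB S (sInf S) := by
  constructor
  · intro θ hθ
    rw [le_iff]
    intro a b h
    exact h _ ⟨θ, hθ, rfl⟩
  · intro φ hφ
    rw [le_iff]
    rintro a b h _ ⟨θ, hθ, rfl⟩
    exact le_iff.1 (hφ hθ) a b h

/-- The congruence lattice of an algebra. -/
noncomputable instance : CompleteLattice (Congr L M) :=
  completeLatticeOfInf _ isGLB_sInf

end Congr

/-- The congruence lattice of `M` is distributive. -/
def IsCongruenceDistributive (M : Bundled.{u} L.Structure) : Prop :=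
  ∀ θ φ ψ : Congr L M, θ ⊓ (φ ⊔ ψ) = (θ ⊓ φ) ⊔ (θ ⊓ ψ)

/-- Any two congruences of `M` permute: `θ ∘ φ = φ ∘ θ`. -/
def IsCongruencePermutable (M : Bundled.{u} L.Structure) : Prop :=
  ∀ (θ φ : Congr L M) (a c : M),
    (∃ b, θ.toSetoid a b ∧ φ.toSetoid b c) ↔ (∃ b, φ.toSetoid a b ∧ θ.toSetoid b c)

/-- An arithmetical variety: a variety all of whose members are congruence distributive and
congruence permutable. -/
def IsArithmeticalVariety (K : AlgClass.{u} L) : Prop :=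
  IsVariety K ∧ ∀ M ∈ K, IsCongruenceDistributive M ∧ IsCongruencePermutable M

/-- `M` is finitely subdirectly irreducible: whenever `M` is subdirectly embedded into the direct
product of a finite (possibly empty) family, one of the projections is an isomorphism. In particular,
`M` is nontrivial (take the empty family). -/
def IsFSI (M : Bundled.{u} L.Structure) : Prop :=
  ∀ (m : ℕ) (N : Fin m → Bundled.{u} L.Structure) (h : M ↪[L] (∀ i, N i)),
    (∀ i, Function.Surjective (fun a : M => h a i)) →
      ∃ i, Function.Bijective (fun a : M => h a i)

/-- The class of finitely subdirectly irreducible members of `K`. -/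
def fsiMembers (K : AlgClass.{u} L) : AlgClass.{u} L :=
  {M | M ∈ K ∧ IsFSI M}

end UniversalAlgebra

/-! ### Expansions by unary implicit operations -/

section Expansions

variable {L : FirstOrder.Language.{0, 0}} {ι : Type}

/-- The formula `φ(x, y)`, with `x` the variable `0` and `y` the variable `1`, is functional in `K`. -/
def IsFunctional (K : AlgClass.{u} L) (φ : L.Formula (Fin 2)) : Prop :=
  ∀ M ∈ K, ∀ a b c : M, φ.Realize ![a, b] → φ.Realize ![a, c] → b = c

/-- The partial function defined by the formula `φ(x, y)` is total on `M`. -/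
def IsTotalOn (M : Bundled.{u} L.Structure) (φ : L.Formula (Fin 2)) : Prop :=
  ∀ a : M, ∃ b : M, φ.Realize ![a, b]

/-- A family of new unary function symbols indexed by `ι`. -/
inductive UnarySymbol (ι : Type) : ℕ → Type
  | op (i : ι) : UnarySymbol ι 1

/-- The language with unary function symbols indexed by `ι` and nothing else. -/
def unaryLang (ι : Type) : FirstOrder.Language.{0, 0} := ⟨UnarySymbol ι, fun _ => Empty⟩

/-- The language `L ∪ {ℓ_i : i ∈ ι}` with each `ℓ_i` a new unary function symbol. -/
abbrev expLang (L : FirstOrder.Language.{0, 0}) (ι : Type) : FirstOrder.Language.{0, 0} := L.sum (unaryLang ι)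

/-- The symbol `ℓ_i` of the expanded language. -/
def newSymbol (i : ι) : (expLang L ι).Functions 1 := Sum.inr (UnarySymbol.op i)

/-- The `L`-reduct of an algebra in the expanded language. -/
def reduct (M : Bundled.{u} (expLang L ι).Structure) : Bundled.{u} L.Structure :=
  ⟨M, (LHom.sumInl : L →ᴸ expLang L ι).reduct M⟩

/-- The class `K[L_F]`, where `F` is the family of the partial functions `f_i` on `K` defined by the
formulas `Φ i` (functional in `K`). Its members are the algebras whose `L`-reduct `A` belongs to `K`
and for which every `f_i^A` is total and is the interpretation of `ℓ_i`. -/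
def expClass (K : AlgClass.{u} L) (Φ : ι → L.Formula (Fin 2)) : AlgClass.{u} (expLang L ι) :=
  {M | reduct M ∈ K ∧ ∀ (i : ι) (a b : reduct M),
    Structure.funMap (M := M) (newSymbol (L := L) i) ![a] = b ↔ (Φ i).Realize ![a, b]}

open Classical in
/-- The algebra `A[L_F]`: the expansion of `A` in which `ℓ_i` is interpreted as the function defined
by the formula `Φ i`. It is meaningful when each `Φ i` is functional and total on `A`. -/
noncomputable def expAlg (A : Bundled.{u} L.Structure) (Φ : ι → L.Formula (Fin 2)) :
    Bundled.{u} (expLang L ι).Structure :=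
  letI : (unaryLang ι).Structure A :=
    { funMap := fun {_} f => match f with
        | UnarySymbol.op i => fun x =>
            if h : ∃ b : A, (Φ i).Realize ![x 0, b] then h.choose else x 0
      RelMap := fun r => r.elim }
  ⟨A, inferInstance⟩

end Expansions

/-! ### The language of Heyting algebras -/

/-- Function symbols for meet, join, implication, bottom and top. -/
inductive HeytingSymbol : ℕ → Type
  | inf : HeytingSymbol 2
  | sup : HeytingSymbol 2
  | imp : HeytingSymbol 2
  | bot : HeytingSymbol 0
  | top : HeytingSymbol 0

/-- The language of Heyting algebras. -/
def heytingLang : FirstOrder.Language.{0, 0} := ⟨HeytingSymbol, fun _ => Empty⟩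

section Terms

variable {α : Type}

def tInf (s t : heytingLang.Term α) : heytingLang.Term α := Term.func HeytingSymbol.inf ![s, t]

def tSup (s t : heytingLang.Term α) : heytingLang.Term α := Term.func HeytingSymbol.sup ![s, t]

def tImp (s t : heytingLang.Term α) : heytingLang.Term α := Term.func HeytingSymbol.imp ![s, t]

def tBot : heytingLang.Term α := Term.func HeytingSymbol.bot ![]

def tTop : heytingLang.Term α := Term.func HeytingSymbol.top ![]

/-- Negation `¬ t`, that is, `t → 0`. -/
def tNeg (t : heytingLang.Term α) : heytingLang.Term α := tImp t tBot

/-- Finite joins; the empty join is `0`. -/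
def tBigSup (l : List (heytingLang.Term α)) : heytingLang.Term α := l.foldr tSup tBot

/-- Finite meets; the empty meet is `1`. -/
def tBigInf (l : List (heytingLang.Term α)) : heytingLang.Term α := l.foldr tInf tTop

/-- The term `d(t) = t ∨ ¬ t`. -/
def tD (t : heytingLang.Term α) : heytingLang.Term α := tSup t (tNeg t)

/-- The meet of the terms `¬ (z_i ∧ z_j)` over all `i ≠ j` with `lo ≤ i, j ≤ hi`, where the entries
of `z` are numbered from `1`: `z_i` is `z (i - 1)`. -/
def tDisjoint {N : ℕ} (z : Fin N → heytingLang.Term α) (lo hi : ℕ) : heytingLang.Term α :=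
  tBigInf
    ((((List.finRange N).product (List.finRange N)).filter fun p =>
        p.1 ≠ p.2 ∧ (lo ≤ p.1.val + 1 ∧ p.1.val + 1 ≤ hi) ∧
          (lo ≤ p.2.val + 1 ∧ p.2.val + 1 ≤ hi)).map
      fun p => tNeg (tInf (z p.1) (z p.2)))

/-- The formula `ψ_{m,n}(x, y, z_1, …, z_{n+1})`, the conjunction of
* `d(x) ≈ d(z_i)` for `1 ≤ i ≤ n + 1`;
* `d(x) ∨ ¬¬(x ∨ s) ≈ y`, where `s = z_1 ∨ … ∨ z_{n+1}`;
* `((s → x) ∧ ⋀_{i ≠ j, 1 ≤ i, j ≤ m+1} ¬(z_i ∧ z_j)) ∨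
   ((s → ¬x) ∧ ⋀_{i ≠ j, m+2 ≤ i, j ≤ n+1} ¬(z_i ∧ z_j)) ≈ 1`. -/
noncomputable def psi (m n : ℕ) (x y : heytingLang.Term α)
    (z : Fin (n + 1) → heytingLang.Term α) : heytingLang.Formula α :=
  let s := tBigSup ((List.finRange (n + 1)).map z)
  (Formula.iInf fun i => Term.equal (tD x) (tD (z i))) ⊓
    (Term.equal (tSup (tD x) (tNeg (tNeg (tSup x s)))) y ⊓
      Term.equal
        (tSup (tInf (tImp s x) (tDisjoint z 1 (m + 1)))
          (tInf (tImp s (tNeg x)) (tDisjoint z (m + 2) (n + 1))))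
        tTop)

end Terms

/-- The bound variables of `φ_{k,n}`: `Sum.inl (m, i)` is `z_{i+1}^{m+1}` and `Sum.inr m` is
`w_{m+1}`. -/
abbrev BoundVar (k n : ℕ) : Type := (Fin k × Fin (n + 1)) ⊕ Fin k

/-- The formula `γ_{k,n}`, that is, `y ≈ w_1 ∨ … ∨ w_k` together with
`ψ_{m,n}(x, w_m, z_1^m, …, z_{n+1}^m)` for `1 ≤ m ≤ k`. -/
noncomputable def gammaFormula (k n : ℕ) : heytingLang.Formula (Fin 2 ⊕ BoundVar k n) :=
  let x : heytingLang.Term (Fin 2 ⊕ BoundVar k n) := Term.var (Sum.inl 0)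
  let y : heytingLang.Term (Fin 2 ⊕ BoundVar k n) := Term.var (Sum.inl 1)
  let z : Fin k → Fin (n + 1) → heytingLang.Term (Fin 2 ⊕ BoundVar k n) :=
    fun m i => Term.var (Sum.inr (Sum.inl (m, i)))
  let w : Fin k → heytingLang.Term (Fin 2 ⊕ BoundVar k n) :=
    fun m => Term.var (Sum.inr (Sum.inr m))
  Term.equal y (tBigSup ((List.finRange k).map w)) ⊓
    Formula.iInf fun m : Fin k => psi (m.val + 1) n x (w m) (z m)

/-- The pp formula `φ_{k,n}(x, y)`, obtained from `γ_{k,n}` by existentially quantifying all the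
variables `z_i^m` and `w_m`. -/
noncomputable def phi (k n : ℕ) : heytingLang.Formula (Fin 2) :=
  Formula.iExs (BoundVar k n) (gammaFormula k n)

/-! ### The algebras `A_κ` -/

/-- The universe of `A_κ`: the subsets of `κ` together with a new maximum `⊤`. -/
abbrev Acarrier (κ : Type u) : Type u := WithTop (Set κ)

open Classical in
/-- The implication of `A_κ`: `a → b` is `1` if `a ≤ b`, it is `b` if `a = 1`, and it is
`(κ - a) ∪ b` if `a` and `b` are subsets of `κ` with `a ⊈ b`. -/
noncomputable def Aimp {κ : Type u} (a b : Acarrier κ) : Acarrier κ :=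
  if a ≤ b then ⊤
  else match a, b with
    | some s, some t => ((sᶜ ∪ t : Set κ) : WithTop (Set κ))
    | _, b => b

/-- `Aimp` is the Heyting implication of the lattice `Acarrier κ`. -/
theorem le_Aimp_iff {κ : Type u} (a b c : Acarrier κ) : c ≤ Aimp a b ↔ c ⊓ a ≤ b := by
  by_cases hab : a ≤ b
  · simp only [Aimp, if_pos hab, le_top, true_iff]
    exact inf_le_right.trans hab
  · induction b using WithTop.recTopCoe with
    | top => exact absurd le_top hab
    | coe t =>
      induction a using WithTop.recTopCoe with
      | top =>
        have h : Aimp (⊤ : Acarrier κ) (t : Acarrier κ) = t := if_neg hab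
        rw [h, inf_top_eq]
      | coe s =>
        have h : Aimp (s : Acarrier κ) (t : Acarrier κ) = ((sᶜ ∪ t : Set κ) : Acarrier κ) :=
          if_neg hab
        rw [h]
        induction c using WithTop.recTopCoe with
        | top =>
          rw [top_inf_eq]
          exact iff_of_false (WithTop.not_top_le_coe _) hab
        | coe r =>
          rw [← WithTop.coe_inf, WithTop.coe_le_coe, WithTop.coe_le_coe]
          change r ⊆ sᶜ ∪ t ↔ r ∩ s ⊆ t
          constructor
          · rintro h i ⟨hr, hs⟩
            exact (h hr).resolve_left (fun hn => hn hs)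
          · intro h i hr
            by_cases hs : i ∈ s
            · exact Or.inr (h ⟨hr, hs⟩)
            · exact Or.inl hs

/-- The algebra `A_κ` in the language of Heyting algebras. -/
noncomputable def algA (κ : Type u) : Bundled.{u} heytingLang.Structure :=
  ⟨Acarrier κ,
    { funMap := fun {_} f => match f with
        | HeytingSymbol.inf => fun x => x 0 ⊓ x 1
        | HeytingSymbol.sup => fun x => x 0 ⊔ x 1
        | HeytingSymbol.imp => fun x => Aimp (x 0) (x 1)
        | HeytingSymbol.bot => fun _ => ⊥
        | HeytingSymbol.top => fun _ => ⊤
      RelMap := fun r => r.elim }⟩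

/-- The algebra `A_n`, for `n` a natural number. -/
noncomputable abbrev algAn (n : ℕ) : Bundled.{u} heytingLang.Structure :=
  algA (ULift.{u} (Fin n))

/-! ### The class `B(n)` and the algebra `B_n` -/

/-- The indices `k` of the implicit operations `f_{k,n}`: the positive integers `k ≤ n - 1`. -/
abbrev OpIndex (n : ℕ) : Type := {k : ℕ // 1 ≤ k ∧ k ≤ n - 1}

/-- The formulas `φ_{k,n}` that define the implicit operations `f_{k,n}` of `𝕍(A_n)`. -/
noncomputable def phiFamily (n : ℕ) : OpIndex n → heytingLang.Formula (Fin 2) :=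
  fun k => phi k.val n

/-- The language of Heyting algebras expanded with a unary symbol for each `f_{k,n}`. -/
abbrev langB (n : ℕ) : FirstOrder.Language.{0, 0} := expLang heytingLang (OpIndex n)

/-- The variety `𝕍(A_n)`. -/
def varA (n : ℕ) : AlgClass.{u} heytingLang := varietyGen {algAn n}

/-- The class `B(n)`: the subalgebras of members of `𝕍(A_n)[L_{F_n}]`. -/
def classB (n : ℕ) : AlgClass.{u} (langB n) := opS (expClass (varA n) (phiFamily n))

/-- The algebra `B_n`, that is, `A_n[L_{F_n}]`. -/
noncomputable def algB (n : ℕ) : Bundled.{u} (langB n).Structure :=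
  expAlg (algAn n) (phiFamily n)

end ImplicitOps

/-! Write `D` for `B_n`. Everything reduces to the claim that the algebras whose points are
separated by homomorphisms to `D` (the members of ISP(`D`)) already form a variety. Only closure
under quotients is at stake. A congruence is determined by its filter, the class of `⊤`, and the
filter is an intersection of prime filters. So it suffices that every prime filter is the preimage
of `⊤` under some homomorphism to `D` (`exists_hom_eq_top_iff`); such homomorphisms factor through
the quotient and separate its points (`separated_of_surjective`). The proof uses only the properties
collected in `IsGenerator`, so it applies to `A_n` as well as to `B_n`.

For `B_n` these properties hold because each new operation takes values in {coatom, `⊤`}, and the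
value `⊤` at `⊥` and `⊤`. That the operations are well defined is a count of points
(`PsiHolds.eq_univ_of_lt`, `PsiHolds.eq_top_of_ncard_eq`, `exists_psiHolds`): for a nonempty proper
subset `X`, `f_k(X)` is `⊤` if `|X| ≤ k` and the coatom otherwise.

The class `B(n)` is ISP(`B_n`) (`classB_eq`). Positive primitive formulas are preserved by
homomorphisms, so homomorphisms of Heyting reducts into `A_n` respect the new operations; they also
pass to products, so powers of `B_n` are admissible expansions. Finally, finite subdirect
irreducibility amounts to `⊤` being join-prime and different from `⊥`, and such separated algebras
embed into `D`. Arithmeticity comes from a Mal'cev term and a majority term in the Heyting language.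
-/

namespace ImplicitOps

/-! ### Heyting reducts of separated algebras -/

section HeytingReducts

variable {L : FirstOrder.Language.{0, 0}}

/-- The operations of `M` named by the Heyting symbols are those of a Heyting algebra. -/
class HeytingReduct (φ : heytingLang →ᴸ L) (M : Type*) [L.Structure M] [HeytingAlgebra M] :
    Prop where
  funMap_inf : ∀ x : Fin 2 → M, Structure.funMap (φ.onFunction HeytingSymbol.inf) x = x 0 ⊓ x 1
  funMap_sup : ∀ x : Fin 2 → M, Structure.funMap (φ.onFunction HeytingSymbol.sup) x = x 0 ⊔ x 1
  funMap_imp : ∀ x : Fin 2 → M, Structure.funMap (φ.onFunction HeytingSymbol.imp) x = x 0 ⇨ x 1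
  funMap_bot : ∀ x : Fin 0 → M, Structure.funMap (φ.onFunction HeytingSymbol.bot) x = ⊥
  funMap_top : ∀ x : Fin 0 → M, Structure.funMap (φ.onFunction HeytingSymbol.top) x = ⊤

/-- The homomorphisms from `M` to `D` separate the points of `M`. -/
def Separated (D : Type*) [L.Structure D] (M : Type*) [L.Structure M] : Prop :=
  ∀ a b : M, (∀ h : M →[L] D, h a = h b) → a = b

/-- Evaluation at all homomorphisms embeds `M` into a power of `D`; the order and the Heyting laws
are pulled back along it. -/
theorem Separated.exists_heytingAlgebra (φ : heytingLang →ᴸ L) {D : Type*} [L.Structure D]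
    [HeytingAlgebra D] [hD : HeytingReduct φ D] {M : Type*} [L.Structure M]
    (hM : Separated (L := L) D M) : ∃ _ : HeytingAlgebra M, HeytingReduct φ M := by
  let f : M → ((M →[L] D) → D) := fun a h => h a
  have hf : Function.Injective f := fun a b hab => hM a b (fun h => congrFun hab h)
  let _ : Min M := ⟨fun a b => Structure.funMap (φ.onFunction HeytingSymbol.inf) ![a, b]⟩
  let _ : Max M := ⟨fun a b => Structure.funMap (φ.onFunction HeytingSymbol.sup) ![a, b]⟩
  let _ : HImp M := ⟨fun a b => Structure.funMap (φ.onFunction HeytingSymbol.imp) ![a, b]⟩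
  let _ : Bot M := ⟨Structure.funMap (φ.onFunction HeytingSymbol.bot) ![]⟩
  let _ : Top M := ⟨Structure.funMap (φ.onFunction HeytingSymbol.top) ![]⟩
  let _ : Compl M := ⟨fun a => a ⇨ ⊥⟩
  let _ : LE M := ⟨fun a b => f a ≤ f b⟩
  let _ : LT M := ⟨fun a b => f a < f b⟩
  have himp : ∀ a b, f (a ⇨ b) = f a ⇨ f b := fun a b => funext fun h =>
    (h.map_fun _ _).trans (hD.funMap_imp _)
  have hbot : f ⊥ = ⊥ := funext fun h => (h.map_fun _ _).trans (hD.funMap_bot _)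
  let H : HeytingAlgebra M := hf.heytingAlgebra f Iff.rfl Iff.rfl
    (fun a b => funext fun h => (h.map_fun _ _).trans (hD.funMap_sup _))
    (fun a b => funext fun h => (h.map_fun _ _).trans (hD.funMap_inf _))
    (funext fun h => (h.map_fun _ _).trans (hD.funMap_top _))
    hbot
    (fun a => by rw [← himp_bot, ← hbot]; exact himp a ⊥)
    himp
  refine ⟨H, ⟨fun x => ?_, fun x => ?_, fun x => ?_, fun x => ?_, fun x => ?_⟩⟩
  · exact congrArg _ (FinVec.etaExpand_eq x).symm
  · exact congrArg _ (FinVec.etaExpand_eq x).symm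
  · exact congrArg _ (FinVec.etaExpand_eq x).symm
  · exact congrArg _ (Subsingleton.elim _ _)
  · exact congrArg _ (Subsingleton.elim _ _)

section Homs

variable (φ : heytingLang →ᴸ L) {M N : Type*} [L.Structure M] [HeytingAlgebra M]
  [hM : HeytingReduct φ M] [L.Structure N] [HeytingAlgebra N] [hN : HeytingReduct φ N]

/-- A homomorphism as a homomorphism of Heyting algebras. -/
def toHeytingHom (h : M →[L] N) : HeytingHom M N where
  toFun := h
  map_sup' a b := by
    have := h.map_fun (φ.onFunction HeytingSymbol.sup) ![a, b]
    rwa [hM.funMap_sup, hN.funMap_sup] at this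
  map_inf' a b := by
    have := h.map_fun (φ.onFunction HeytingSymbol.inf) ![a, b]
    rwa [hM.funMap_inf, hN.funMap_inf] at this
  map_bot' := by
    have := h.map_fun (φ.onFunction HeytingSymbol.bot) ![]
    rwa [hM.funMap_bot, hN.funMap_bot] at this
  map_himp' a b := by
    have := h.map_fun (φ.onFunction HeytingSymbol.imp) ![a, b]
    rwa [hM.funMap_imp, hN.funMap_imp] at this

include φ hM hN

theorem hom_sup (h : M →[L] N) (a b : M) : h (a ⊔ b) = h a ⊔ h b :=
  map_sup (toHeytingHom φ h) a b

theorem hom_inf (h : M →[L] N) (a b : M) : h (a ⊓ b) = h a ⊓ h b :=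
  map_inf (toHeytingHom φ h) a b

theorem hom_himp (h : M →[L] N) (a b : M) : h (a ⇨ b) = h a ⇨ h b :=
  map_himp (toHeytingHom φ h) a b

theorem hom_compl (h : M →[L] N) (a : M) : h aᶜ = (h a)ᶜ :=
  map_compl (toHeytingHom φ h) a

theorem hom_bihimp (h : M →[L] N) (a b : M) : h (bihimp a b) = bihimp (h a) (h b) :=
  map_bihimp (toHeytingHom φ h) a b

theorem hom_top (h : M →[L] N) : h ⊤ = ⊤ := map_top (toHeytingHom φ h)

theorem hom_bot (h : M →[L] N) : h ⊥ = ⊥ := map_bot (toHeytingHom φ h)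

end Homs

/-! ### Congruences: filters, permutability, distributivity -/

section Congruences

/-- The kernel of a homomorphism. -/
def kerCongr {M : Type u} {N : Type*} [L.Structure M] [L.Structure N] (h : M →[L] N) :
    Congr L M where
  toSetoid := Setoid.ker h
  compat f x y hxy := by
    change h _ = h _
    rw [h.map_fun, h.map_fun]
    exact congrArg _ (funext hxy)

variable (φ : heytingLang →ᴸ L) {M : Type u} [L.Structure M] [HeytingAlgebra M]
  [hM : HeytingReduct φ M] (θ : Congr L M) {a a' b b' : M}

include φ hM

theorem congr_inf (h : θ.toSetoid a a') (h' : θ.toSetoid b b') :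
    θ.toSetoid (a ⊓ b) (a' ⊓ b') := by
  have := θ.compat (φ.onFunction HeytingSymbol.inf) ![a, b] ![a', b'] (Fin.forall_fin_two.2 ⟨h, h'⟩)
  rwa [hM.funMap_inf, hM.funMap_inf] at this

theorem congr_sup (h : θ.toSetoid a a') (h' : θ.toSetoid b b') :
    θ.toSetoid (a ⊔ b) (a' ⊔ b') := by
  have := θ.compat (φ.onFunction HeytingSymbol.sup) ![a, b] ![a', b'] (Fin.forall_fin_two.2 ⟨h, h'⟩)
  rwa [hM.funMap_sup, hM.funMap_sup] at this

theorem congr_himp (h : θ.toSetoid a a') (h' : θ.toSetoid b b') :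
    θ.toSetoid (a ⇨ b) (a' ⇨ b') := by
  have := θ.compat (φ.onFunction HeytingSymbol.imp) ![a, b] ![a', b'] (Fin.forall_fin_two.2 ⟨h, h'⟩)
  rwa [hM.funMap_imp, hM.funMap_imp] at this

/-- This is what makes a congruence determined by its class of `⊤`: meeting with `bihimp a b`
equalizes `a` and `b`. -/
theorem congr_bihimp_top_iff : θ.toSetoid (bihimp a b) ⊤ ↔ θ.toSetoid a b := by
  constructor
  · intro h
    have h1 := congr_inf φ θ h (θ.toSetoid.refl a)
    have h2 := congr_inf φ θ h (θ.toSetoid.refl b)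
    have e : bihimp a b ⊓ a = bihimp a b ⊓ b := by
      apply le_antisymm
      · refine le_inf inf_le_left ?_
        rw [← le_himp_iff, bihimp_def]
        exact inf_le_right
      · refine le_inf inf_le_left ?_
        rw [← le_himp_iff, bihimp_def]
        exact inf_le_left
    rw [top_inf_eq] at h1 h2
    rw [e] at h1
    exact θ.toSetoid.trans (θ.toSetoid.symm h1) h2
  · intro h
    have h1 := congr_inf φ θ (congr_himp φ θ (θ.toSetoid.refl b) h)
      (congr_himp φ θ h (θ.toSetoid.refl b))
    rwa [← bihimp_def, himp_self, top_inf_eq] at h1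

/-- The witness is the Mal'cev term `((x ⇨ y) ⇨ z) ⊓ ((z ⇨ y) ⇨ x)` at `(a, b, c)`; it returns `x`
when `y = z` and `z` when `x = y`. -/
theorem congr_permute (θ ψ : Congr L M) {a b c : M} (h : θ.toSetoid a b) (h' : ψ.toSetoid b c) :
    ∃ d, ψ.toSetoid a d ∧ θ.toSetoid d c := by
  have key : ∀ x y : M, ((x ⇨ y) ⇨ y) ⊓ ((y ⇨ y) ⇨ x) = x := fun x y => by
    rw [himp_self, top_himp]
    exact inf_eq_right.2 le_himp_himp
  have key' : ∀ x y : M, ((y ⇨ y) ⇨ x) ⊓ ((x ⇨ y) ⇨ y) = x := fun x y => by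
    rw [inf_comm, key]
  refine ⟨((a ⇨ b) ⇨ c) ⊓ ((c ⇨ b) ⇨ a), ?_, ?_⟩
  · have h1 := congr_inf φ ψ
      (congr_himp φ ψ (ψ.toSetoid.refl (a ⇨ b)) h')
      (congr_himp φ ψ (congr_himp φ ψ h' (ψ.toSetoid.refl b)) (ψ.toSetoid.refl a))
    rwa [key] at h1
  · have h1 := congr_inf φ θ
      (congr_himp φ θ (congr_himp φ θ h (θ.toSetoid.refl b)) (θ.toSetoid.refl c))
      (congr_himp φ θ (θ.toSetoid.refl (c ⇨ b)) h)
    rwa [key'] at h1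

/-- By permutability the relational composite is itself a congruence. -/
theorem congr_sup_iff (θ ψ : Congr L M) {a c : M} :
    (θ ⊔ ψ).toSetoid a c ↔ ∃ b, θ.toSetoid a b ∧ ψ.toSetoid b c := by
  constructor
  · let χ : Congr L M :=
      { r := fun a c => ∃ b, θ.toSetoid a b ∧ ψ.toSetoid b c
        iseqv :=
          { refl := fun a => ⟨a, θ.toSetoid.refl a, ψ.toSetoid.refl a⟩
            symm := fun ⟨b, h1, h2⟩ =>
              congr_permute φ ψ θ (ψ.toSetoid.symm h2) (θ.toSetoid.symm h1)
            trans := fun ⟨b, h1, h2⟩ ⟨d, h3, h4⟩ => by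
              obtain ⟨e, h5, h6⟩ := congr_permute φ ψ θ h2 h3
              exact ⟨e, θ.toSetoid.trans h1 h5, ψ.toSetoid.trans h6 h4⟩ }
        compat := fun f x y h => by
          choose z hz hz' using h
          exact ⟨_, θ.compat f x z hz, ψ.compat f z y hz'⟩ }
    have h1 : θ ≤ χ := Congr.le_iff.2 fun a b h => ⟨b, h, ψ.toSetoid.refl b⟩
    have h2 : ψ ≤ χ := Congr.le_iff.2 fun a b h => ⟨a, θ.toSetoid.refl a, h⟩
    exact Congr.le_iff.1 (sup_le h1 h2) a c
  · rintro ⟨b, h1, h2⟩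
    exact (θ ⊔ ψ).toSetoid.trans (Congr.le_iff.1 le_sup_left _ _ h1)
      (Congr.le_iff.1 le_sup_right _ _ h2)

omit φ [HeytingAlgebra M] hM in
theorem congr_inf_iff (θ ψ : Congr L M) {a b : M} :
    (θ ⊓ ψ).toSetoid a b ↔ θ.toSetoid a b ∧ ψ.toSetoid a b := by
  constructor
  · intro h
    exact ⟨Congr.le_iff.1 inf_le_left _ _ h, Congr.le_iff.1 inf_le_right _ _ h⟩
  · let χ : Congr L M :=
      { toSetoid := θ.toSetoid ⊓ ψ.toSetoid
        compat := fun f x y h =>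
          ⟨θ.compat f x y fun i => (h i).1, ψ.compat f x y fun i => (h i).2⟩ }
    have h1 : χ ≤ θ := Congr.le_iff.2 fun a b h => h.1
    have h2 : χ ≤ ψ := Congr.le_iff.2 fun a b h => h.2
    exact Congr.le_iff.1 (le_inf h1 h2) a b

/-- The lattice median is a majority term. If `b` links `a` to `c` through `ψ` and `χ`, the median
of `a, b, c` is another link, and it is `θ`-related to both ends. -/
theorem congr_distrib (θ ψ χ : Congr L M) : θ ⊓ (ψ ⊔ χ) = (θ ⊓ ψ) ⊔ (θ ⊓ χ) := by
  refine le_antisymm (Congr.le_iff.2 fun a c h => ?_) le_inf_sup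
  obtain ⟨hθ, hs⟩ := (congr_inf_iff _ _).1 h
  obtain ⟨b, hab, hbc⟩ := (congr_sup_iff φ _ _).1 hs
  have med : ∀ (ρ : Congr L M) {x x' y y' z z' : M}, ρ.toSetoid x x' → ρ.toSetoid y y' →
      ρ.toSetoid z z' → ρ.toSetoid ((x ⊓ y) ⊔ (y ⊓ z) ⊔ (z ⊓ x)) ((x' ⊓ y') ⊔ (y' ⊓ z') ⊔ (z' ⊓ x')) :=
    fun ρ _ _ _ _ _ _ hx hy hz => congr_sup φ ρ (congr_sup φ ρ (congr_inf φ ρ hx hy)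
      (congr_inf φ ρ hy hz)) (congr_inf φ ρ hz hx)
  have m1 : ∀ x y : M, (x ⊓ x) ⊔ (x ⊓ y) ⊔ (y ⊓ x) = x := fun x y => by simp
  have m2 : ∀ x y : M, (x ⊓ y) ⊔ (y ⊓ y) ⊔ (y ⊓ x) = y := fun x y => by simp
  have m3 : ∀ x y : M, (x ⊓ y) ⊔ (y ⊓ x) ⊔ (x ⊓ x) = x := fun x y => by simp [inf_comm y x]
  have r := fun (ρ : Congr L M) (x : M) => ρ.toSetoid.refl x
  have h1 := med θ (r θ a) (r θ b) (θ.toSetoid.symm hθ)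
  rw [m3] at h1
  have h2 := med ψ (r ψ a) hab (r ψ c)
  rw [m1] at h2
  have h3 := med χ (r χ a) hbc (r χ c)
  rw [m2] at h3
  exact (congr_sup_iff φ _ _).2 ⟨_, (congr_inf_iff _ _).2 ⟨θ.toSetoid.symm h1, h2⟩,
    (congr_inf_iff _ _).2 ⟨θ.toSetoid.trans h1 hθ, h3⟩⟩

end Congruences

end HeytingReducts

end ImplicitOps

namespace ImplicitOps

/-! ### Prime filters, quotients and homomorphisms to a generator -/

section Generators

variable {L : FirstOrder.Language.{0, 0}}

/-- A finite well-connected Heyting algebra of depth at most two, with further operations that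
preserve `{⊥, ⊤}` and respect all filters. -/
structure IsGenerator (L : FirstOrder.Language.{0, 0}) (D : Type u) [L.Structure D]
    [HeytingAlgebra D] : Prop where
  finite : Finite D
  bot_ne_top : (⊥ : D) ≠ ⊤
  sup_eq_top : ∀ a b : D, a ⊔ b = ⊤ → a = ⊤ ∨ b = ⊤
  depth_two : ∀ a b : D, a ⊔ (a ⇨ (b ⊔ bᶜ)) = ⊤
  compat : ∀ {m : ℕ} (f : L.Functions m) (x y : Fin m → D) (a : D),
    (∀ i, a ⊓ x i = a ⊓ y i) → a ⊓ Structure.funMap f x = a ⊓ Structure.funMap f y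
  two : ∀ {m : ℕ} (f : L.Functions m) (x : Fin m → D), (∀ i, x i = ⊥ ∨ x i = ⊤) →
    Structure.funMap f x = ⊥ ∨ Structure.funMap f x = ⊤

variable (φ : heytingLang →ᴸ L) {D : Type u} [L.Structure D] [HeytingAlgebra D]
  [hD : HeytingReduct φ D]

section

variable {M : Type u} [L.Structure M] [HeytingAlgebra M]
  [hM : HeytingReduct φ M] (hs : Separated (L := L) D M)

include φ hD hM hs

theorem separated_depth_two (hg : IsGenerator L D) (a b : M) : a ⊔ (a ⇨ (b ⊔ bᶜ)) = ⊤ :=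
  hs _ _ fun h => by
    rw [hom_sup φ, hom_himp φ, hom_sup φ, hom_compl φ, hom_top φ, hg.depth_two]

theorem separated_compat (hg : IsGenerator L D) {m : ℕ} (f : L.Functions m) (x y : Fin m → M)
    (a : M) (hxy : ∀ i, a ⊓ x i = a ⊓ y i) :
    a ⊓ Structure.funMap f x = a ⊓ Structure.funMap f y :=
  hs _ _ fun h => by
    rw [hom_inf φ, hom_inf φ, h.map_fun, h.map_fun]
    exact hg.compat f _ _ _ fun i => by
      rw [Function.comp_apply, Function.comp_apply, ← hom_inf φ, ← hom_inf φ, hxy]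

theorem separated_exists_ne_top {a : M} (ha : a ≠ ⊤) : ∃ h : M →[L] D, h a ≠ ⊤ := by
  by_contra! hc
  exact ha (hs _ _ fun h => by rw [hc, hom_top φ])

omit [HeytingAlgebra D] hD [HeytingAlgebra M] hM hs φ in
/-- The ultraproduct of a family of homomorphisms into a finite algebra. -/
theorem exists_ultralimit_hom [L.IsAlgebraic] [Finite D] {ι : Type*} (U : Ultrafilter ι)
    (h : ι → M →[L] D) : ∃ g : M →[L] D, ∀ a, ∀ᶠ i in (U : Filter ι), h i a = g a := by
  -- An ultrafilter on the finite set `D` is principal, so each `a` has a limit value.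
  have hex : ∀ a, ∃ v : D, ∀ᶠ i in (U : Filter ι), h i a = v := by
    intro a
    obtain ⟨v, hv⟩ := Ultrafilter.eq_pure_of_finite (U.map fun i => h i a)
    refine ⟨v, ?_⟩
    have : ({v} : Set D) ∈ U.map fun i => h i a := by
      rw [hv]
      exact Set.mem_singleton v
    exact this
  choose g hg using hex
  refine ⟨⟨g, fun {m} f x => ?_, fun r => isEmptyElim r⟩, hg⟩
  have h1 : ∀ᶠ i in (U : Filter ι), ∀ j, h i (x j) = g (x j) :=
    Filter.eventually_all.2 fun j => hg (x j)
  obtain ⟨i, hi, hi'⟩ := (h1.and (hg (Structure.funMap f x))).exists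
  rw [← hi', (h i).map_fun]
  exact congrArg _ (funext hi)

/-- Every prime ideal avoids the filter of some homomorphism. -/
theorem exists_hom_ne_top_of_mem [L.IsAlgebraic] (hg : IsGenerator L D) (J : Order.Ideal M)
    (hJ : ⊤ ∉ J) : ∃ h : M →[L] D, ∀ a ∈ J, h a ≠ ⊤ := by
  have := hg.finite
  have hne : ∀ a : J, ∃ h : M →[L] D, h a.1 ≠ ⊤ := fun a =>
    separated_exists_ne_top φ hs fun e => hJ (e ▸ a.2)
  choose h hh using hne
  have : Nonempty J := ⟨⟨⊥, J.bot_mem⟩⟩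
  -- `J` indexes its own homomorphisms. An ultrafilter finer than `atTop` makes the limit avoid `⊤`
  -- on all of `J`: a larger index `b ≥ a` with `h b a = ⊤` would give `h b b = ⊤`.
  have : IsDirectedOrder J := ⟨fun a b =>
    ⟨⟨a.1 ⊔ b.1, Order.Ideal.sup_mem a.2 b.2⟩, le_sup_left (a := a.1), le_sup_right (a := a.1)⟩⟩
  obtain ⟨g, hgl⟩ := exists_ultralimit_hom (Ultrafilter.of (Filter.atTop : Filter J)) h
  refine ⟨g, fun a ha htop => ?_⟩
  have h1 := Ultrafilter.of_le (Filter.atTop : Filter J) (Filter.mem_atTop (⟨a, ha⟩ : J))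
  obtain ⟨b, hb, hb'⟩ := (Filter.Eventually.and h1 (hgl a)).exists
  refine hh b (top_unique ?_)
  have hab : a ≤ b.1 := hb
  have h2 : h b (a ⊔ b.1) = h b a ⊔ h b b.1 := hom_sup φ _ _ _
  rw [sup_eq_right.2 hab] at h2
  rw [h2, hb', htop]
  exact le_sup_left

/-- Every prime filter is the filter of some homomorphism. -/
theorem exists_hom_eq_top_iff [L.IsAlgebraic] (hg : IsGenerator L D) (J : Order.Ideal M)
    (hJ : J.IsPrime) : ∃ h : M →[L] D, ∀ a, h a = ⊤ ↔ a ∉ J := by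
  classical
  have htop : ⊤ ∉ J := hJ.toIsProper.top_notMem
  have hinf : ∀ {a b}, a ∉ J → b ∉ J → a ⊓ b ∉ J := fun ha hb hab =>
    (hJ.mem_or_mem hab).elim ha hb
  obtain ⟨h, hh⟩ := exists_hom_ne_top_of_mem φ hs hg J htop
  -- If some `x ⊔ xᶜ` lies in `J`, depth two leaves no room between `h ⁻¹ {⊤}` and the complement of
  -- `J`. Otherwise that complement is an ultrafilter, and its characteristic function serves as the
  -- homomorphism.
  by_cases hd : ∃ x, x ⊔ xᶜ ∈ J
  · obtain ⟨x, hx⟩ := hd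
    refine ⟨h, fun a => ⟨fun ha haJ => hh a haJ ha, fun ha => ?_⟩⟩
    have h1 := hg.depth_two (h a) (h x)
    refine (hg.sup_eq_top _ _ h1).resolve_right fun h2 => ?_
    rw [← hom_compl φ, ← hom_sup φ, ← hom_himp φ] at h2
    have h3 : a ⇨ (x ⊔ xᶜ) ∉ J := fun hm => hh _ hm h2
    exact hinf ha h3 (J.lower inf_himp_le hx)
  · push Not at hd
    let g : M → D := fun a => if a ∈ J then ⊥ else ⊤
    have hgt : ∀ a, g a = ⊤ ↔ a ∉ J := fun a => by
      by_cases ha : a ∈ J <;> simp [g, ha, hg.bot_ne_top]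
    refine ⟨⟨g, fun {m} f x => ?_, fun r => isEmptyElim r⟩, hgt⟩
    let y : Fin m → M := fun i => if x i ∈ J then ⊥ else ⊤
    -- The meet of these elements lies outside `J`, and below it each `x i` agrees with the constant
    -- `y i`. So `compat` reduces the value of `f` at `x` to its value at constants, which `two`
    -- controls.
    let a : Fin m → M := fun i => if x i ∈ J then (x i)ᶜ else x i
    have ha : Finset.univ.inf a ∉ J := by
      refine Finset.inf_induction (p := fun b => b ∉ J) htop (fun _ h1 _ h2 => hinf h1 h2)
        fun i _ => ?_
      by_cases hi : x i ∈ J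
      · simp only [a, if_pos hi]
        exact fun hc => hd (x i) (Order.Ideal.sup_mem hi hc)
      · simpa only [a, if_neg hi]
    have hc := separated_compat φ hs hg f x y (Finset.univ.inf a) fun i => by
      have hi := Finset.inf_le (f := a) (Finset.mem_univ i)
      by_cases hxi : x i ∈ J
      · simp only [a, y, if_pos hxi] at hi ⊢
        rw [inf_bot_eq, ← le_bot_iff, ← le_himp_iff, himp_bot]
        exact hi
      · simp only [a, y, if_neg hxi] at hi ⊢
        rw [inf_top_eq, inf_eq_left]
        exact hi
    have hy : ∀ k : M →[L] D, k ∘ y = g ∘ x := fun k => funext fun i => by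
      by_cases hxi : x i ∈ J
      · simp only [Function.comp, y, g, if_pos hxi, hom_bot φ]
      · simp only [Function.comp, y, g, if_neg hxi, hom_top φ]
    rcases hg.two f (g ∘ x) (fun i => by
      by_cases hxi : x i ∈ J <;> simp [g, hxi]) with h0 | h1
    · have e : Structure.funMap f y = ⊥ := hs _ _ fun k => by
        rw [k.map_fun, hy, h0, hom_bot φ]
      rw [e, inf_bot_eq] at hc
      have hm : Structure.funMap f x ∈ J := by
        by_contra hcon
        exact hinf ha hcon (hc ▸ J.bot_mem)
      rw [h0]
      simp [g, hm]
    · have e : Structure.funMap f y = ⊤ := hs _ _ fun k => by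
        rw [k.map_fun, hy, h1, hom_top φ]
      rw [e, inf_top_eq, inf_eq_left] at hc
      have hm : Structure.funMap f x ∉ J := fun hcon => ha (J.lower hc hcon)
      rw [h1]
      exact (hgt _).2 hm

/-- Homomorphic images of separated algebras are separated. -/
theorem separated_of_surjective [L.IsAlgebraic] (hg : IsGenerator L D) {N : Type u} [L.Structure N]
    (p : M →[L] N) (hp : Function.Surjective p) : Separated (L := L) D N := by
  intro a b hab
  obtain ⟨a, rfl⟩ := hp a
  obtain ⟨b, rfl⟩ := hp b
  by_contra hne
  have hker : ∀ x y, p (bihimp x y) = p ⊤ ↔ p x = p y := fun x y =>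
    congr_bihimp_top_iff φ (kerCongr p)
  have hup : ∀ {x y}, x ≤ y → p x = p ⊤ → p y = p ⊤ := fun {x y} hxy hx => by
    have := congr_sup φ (kerCongr p) (a := x) (a' := ⊤) hx ((kerCongr p).toSetoid.refl y)
    rwa [sup_eq_right.2 hxy, top_sup_eq] at this
  -- Separating the filter of `p` from `bihimp a b` by a prime ideal yields a homomorphism that
  -- factors through `p` but distinguishes `a` from `b`.
  let F : Order.PFilter M := Order.IsPFilter.toPFilter (F := {x | p x = p ⊤})
    (Order.IsPFilter.of_def ⟨⊤, rfl⟩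
      (fun x hx y hy => ⟨x ⊓ y, by
        have := congr_inf φ (kerCongr p) (a := x) (a' := ⊤) (b := y) (b' := ⊤) hx hy
        rwa [inf_top_eq] at this, inf_le_left, inf_le_right⟩)
      fun {x y} hxy hx => hup hxy hx)
  have hF : Disjoint (F : Set M) (Order.Ideal.principal (bihimp a b) : Set M) := by
    rw [Set.disjoint_left]
    intro x hx hxb
    exact hne ((hker a b).1 (hup hxb hx))
  obtain ⟨J, hJ, hIJ, hFJ⟩ := DistribLattice.prime_ideal_of_disjoint_filter_ideal hF
  obtain ⟨h, hh⟩ := exists_hom_eq_top_iff φ hs hg J hJ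
  have hfac : ∀ x y, p x = p y → h x = h y := fun x y hxy => by
    have h1 : bihimp x y ∉ J := Set.disjoint_left.1 hFJ ((hker x y).2 hxy)
    rw [← bihimp_eq_top, ← hom_bihimp φ]
    exact (hh _).2 h1
  let s := Function.surjInv hp
  have hsurj : ∀ x, p (s x) = x := Function.surjInv_eq hp
  let g : N →[L] D := ⟨fun x => h (s x), fun {m} f x => by
      have : p (s (Structure.funMap f x)) = p (Structure.funMap f (s ∘ x)) := by
        rw [hsurj, p.map_fun]
        exact congrArg _ (funext fun i => (hsurj (x i)).symm)
      rw [hfac _ _ this, h.map_fun]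
      rfl, fun r => isEmptyElim r⟩
  have h1 : h a = h b := (hfac _ _ (hsurj (p a)).symm).trans ((hab g).trans (hfac _ _ (hsurj (p b))))
  rw [← bihimp_eq_top, ← hom_bihimp φ, hh] at h1
  exact h1 (hIJ (Order.Ideal.mem_principal.2 le_rfl))

/-- A well-connected separated algebra embeds into the generator. -/
theorem exists_injective_hom (hg : IsGenerator L D) (hne : (⊥ : M) ≠ ⊤)
    (hw : ∀ a b : M, a ⊔ b = ⊤ → a = ⊤ ∨ b = ⊤) : ∃ h : M →[L] D, Function.Injective h := by
  suffices ∃ h : M →[L] D, ∀ a, h a = ⊤ → a = ⊤ by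
    obtain ⟨h, hh⟩ := this
    refine ⟨h, fun a b hab => ?_⟩
    rw [← bihimp_eq_top]
    apply hh
    rw [hom_bihimp φ, bihimp_eq_top]
    exact hab
  -- If `x ⊔ xᶜ ≠ ⊤`, depth two and well-connectedness put every `a ≠ ⊤` below `x ⊔ xᶜ`, so it is
  -- enough not to send that element to `⊤`. Otherwise `M` is just `{⊥, ⊤}`.
  by_cases hd : ∃ x : M, x ⊔ xᶜ ≠ ⊤
  · obtain ⟨x, hx⟩ := hd
    obtain ⟨h, hh⟩ := separated_exists_ne_top φ hs hx
    refine ⟨h, fun a ha => ?_⟩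
    refine (hw _ _ (separated_depth_two φ hs hg a x)).resolve_right fun h1 => hh ?_
    have h2 : h (a ⊔ (x ⊔ xᶜ)) = h a ⊔ h (x ⊔ xᶜ) := hom_sup φ _ _ _
    rw [himp_eq_top_iff] at h1
    rw [sup_eq_right.2 h1, ha, top_sup_eq] at h2
    exact h2
  · push Not at hd
    obtain ⟨h, hh⟩ := separated_exists_ne_top φ hs hne
    refine ⟨h, fun a ha => (hw _ _ (hd a)).resolve_right fun h1 => hh ?_⟩
    have h2 : a = ⊥ := by
      rw [← le_bot_iff]
      have := inf_compl_self a
      rw [h1, inf_top_eq] at this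
      exact this.le
    rw [← h2, ha]

end

/-! ### The variety generated by a generator and its finitely subdirectly irreducible members -/

section

variable [L.IsAlgebraic]

omit [HeytingAlgebra D] [L.IsAlgebraic] in
theorem Separated.of_injective {M N : Type*} [L.Structure M] [L.Structure N]
    (hs : Separated (L := L) D N) (p : M →[L] N) (hp : Function.Injective p) :
    Separated (L := L) D M :=
  fun _ _ hab => hp (hs _ _ fun h => hab (h.comp p))

/-- The projections of a direct product. -/
def projHom {ι : Type*} (N : ι → Type*) [∀ i, L.Structure (N i)] (i : ι) : (∀ i, N i) →[L] N i :=
  ⟨fun a => a i, fun _ _ => rfl, fun r => isEmptyElim r⟩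

/-- The homomorphism into a direct product with given components. -/
def prodHom {ι : Type*} {M : Type*} [L.Structure M] (N : ι → Type*) [∀ i, L.Structure (N i)]
    (h : ∀ i, M →[L] N i) : M →[L] (∀ i, N i) :=
  ⟨fun a i => h i a, fun f x => funext fun i => (h i).map_fun f x, fun r => isEmptyElim r⟩

omit [HeytingAlgebra D] in
theorem separated_pi {ι : Type*} (N : ι → Type*) [∀ i, L.Structure (N i)]
    (hs : ∀ i, Separated (L := L) D (N i)) : Separated (L := L) D (∀ i, N i) :=
  fun _ _ hab => funext fun i => hs i _ _ fun h => hab (h.comp (projHom N i))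

variable (D) in
/-- The algebras whose points are separated by homomorphisms to `D`. -/
def separatedClass : AlgClass.{u} L := {M | Separated (L := L) D M}

include φ hD

theorem isVariety_separatedClass (hg : IsGenerator L D) :
    IsVariety (separatedClass (L := L) D) where
  closed_H := by
    rintro N ⟨M, hM, p, hp⟩
    obtain ⟨_, _⟩ := Separated.exists_heytingAlgebra φ (D := D) hM
    exact separated_of_surjective φ hM hg p hp
  closed_S := by
    rintro M ⟨N, hN, ⟨p⟩⟩
    exact Separated.of_injective hN p.toHom p.injective
  closed_P := by
    rintro M ⟨ι, N, hN, ⟨p⟩⟩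
    exact Separated.of_injective (separated_pi (fun i => N i) hN) p.toHom p.injective

omit φ [HeytingAlgebra D] hD in
theorem exists_embedding_power {M : Type u} [L.Structure M] (hM : Separated (L := L) D M) :
    Nonempty (M ↪[L] ((M →[L] D) → D)) :=
  ⟨Embedding.ofInjective (f := prodHom (fun _ : M →[L] D => D) id)
    fun a b hab => hM a b fun h => congrFun hab h⟩

theorem varietyGen_eq_separatedClass (hg : IsGenerator L D) :
    varietyGen {(⟨D, inferInstance⟩ : Bundled.{u} L.Structure)} = separatedClass (L := L) D := by
  apply Set.Subset.antisymm
  · refine Set.sInter_subset_of_mem ⟨isVariety_separatedClass φ hg, ?_⟩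
    rintro _ rfl
    exact fun a b hab => hab (Hom.id L D)
  · rintro M hM V ⟨hV, hDV⟩
    obtain ⟨e⟩ := exists_embedding_power (D := D) hM
    refine hV.closed_S ⟨⟨(M →[L] D) → D, inferInstance⟩, hV.closed_P ?_, ⟨e⟩⟩
    exact ⟨M →[L] D, fun _ => ⟨D, inferInstance⟩, fun _ => hDV rfl, ⟨FirstOrder.Language.Equiv.refl L _⟩⟩

theorem isArithmeticalVariety_separatedClass (hg : IsGenerator L D) :
    IsArithmeticalVariety (separatedClass (L := L) D) := by
  refine ⟨isVariety_separatedClass φ hg, fun M hM => ?_⟩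
  obtain ⟨_, _⟩ := Separated.exists_heytingAlgebra φ (D := D) hM
  exact ⟨congr_distrib φ, fun θ ψ a c =>
    ⟨fun ⟨_, h, h'⟩ => congr_permute φ θ ψ h h', fun ⟨_, h, h'⟩ => congr_permute φ ψ θ h h'⟩⟩

/-- A finitely subdirectly irreducible separated algebra is nontrivial and well-connected. -/
theorem IsFSI.wellConnected (hg : IsGenerator L D) {M : Bundled.{u} L.Structure}
    [HeytingAlgebra M] [HeytingReduct φ M] (hs : Separated (L := L) D M) (hM : IsFSI M) :
    (⊥ : M) ≠ ⊤ ∧ ∀ a b : M, a ⊔ b = ⊤ → a = ⊤ ∨ b = ⊤ := by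
  constructor
  · intro h
    have hsub : ∀ a b : M, a = b := fun a b =>
      (eq_bot_of_bot_eq_top h a).trans (eq_bot_of_bot_eq_top h b).symm
    -- A trivial algebra embeds subdirectly into the empty product, which has no projection.
    let N : Fin 0 → Bundled.{u} L.Structure := fun i => i.elim0
    obtain ⟨i, _⟩ := hM 0 N (Embedding.ofInjective
      (f := prodHom (fun i => N i) fun i => i.elim0) fun a b _ => hsub a b) fun i => i.elim0
    exact i.elim0
  · intro a b hab
    let c : Fin 2 → M := ![a, b]
    -- Since `⊤` is join-prime in `D`, every homomorphism sends `a` or `b` to `⊤`. Grouping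
    -- homomorphisms accordingly gives a two-factor subdirect decomposition in which the `i`-th
    -- projection identifies `c i` with `⊤`.
    let p : ∀ i, M →[L] ({h : M →[L] D // h (c i) = ⊤} → D) := fun i => prodHom _ fun h => h.1
    let N : Fin 2 → Bundled.{u} L.Structure := fun i => ⟨(p i).range, inferInstance⟩
    let q : ∀ i, M →[L] N i := fun i =>
      ⟨fun x => ⟨p i x, ⟨x, rfl⟩⟩, fun f x => Subtype.ext ((p i).map_fun f x),
        fun r => isEmptyElim r⟩
    have hc : ∀ h : M →[L] D, ∃ i, h (c i) = ⊤ := fun h => by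
      have h1 := hom_sup φ h a b
      rw [hab, hom_top φ] at h1
      rcases hg.sup_eq_top _ _ h1.symm with h2 | h2
      · exact ⟨0, h2⟩
      · exact ⟨1, h2⟩
    obtain ⟨i, hi⟩ := hM 2 N (Embedding.ofInjective (f := prodHom (fun i => N i) q)
      fun x y hxy => hs _ _ fun h => by
        obtain ⟨i, hi⟩ := hc h
        have h1 : q i x = q i y := congrFun hxy i
        exact congrFun (congrArg Subtype.val h1) (⟨h, hi⟩ : {h : M →[L] D // h (c i) = ⊤}))
      fun i => by
        rintro ⟨_, x, rfl⟩
        exact ⟨x, rfl⟩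
    have h1 : c i = ⊤ := hi.1 (Subtype.ext (funext fun h => h.2.trans (hom_top φ h.1).symm))
    revert h1
    refine Fin.cases (fun h => Or.inl h) (fun j => ?_) i
    obtain rfl : j = 0 := Subsingleton.elim _ _
    exact fun h => Or.inr h

omit hD [L.IsAlgebraic] in
/-- A nontrivial well-connected algebra is finitely subdirectly irreducible. -/
theorem IsFSI.of_wellConnected {M : Bundled.{u} L.Structure}
    [HeytingAlgebra M] [HeytingReduct φ M] (hne : (⊥ : M) ≠ ⊤)
    (hw : ∀ a b : M, a ⊔ b = ⊤ → a = ⊤ ∨ b = ⊤) : IsFSI M := by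
  intro m N h hsurj
  by_contra! hcon
  -- Each non-injective projection collapses some `c i ≠ ⊤` to `⊤`. The join of all `c i` is then
  -- collapsed by every projection, yet differs from `⊤` by well-connectedness.
  have h1 : ∀ i, ∃ c : M, c ≠ ⊤ ∧ h c i = h ⊤ i := by
    intro i
    have h2 : ¬ Function.Injective fun a : M => h a i := fun hinj => hcon i ⟨hinj, hsurj i⟩
    simp only [Function.Injective, not_forall] at h2
    obtain ⟨a, b, hab, hne⟩ := h2
    let p : M →[L] N i := ⟨fun a => h a i, fun f x => congrFun (h.map_fun f x) i,
      fun r x hr => (h.map_rel r x).2 hr i⟩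
    exact ⟨bihimp a b, fun e => hne (bihimp_eq_top.1 e),
      (congr_bihimp_top_iff φ (kerCongr p)).2 hab⟩
  choose c hc hc' using h1
  have h2 : Finset.univ.sup c ≠ ⊤ :=
    Finset.sup_induction (p := fun x => x ≠ ⊤) hne
      (fun x hx y hy hxy => (hw x y hxy).elim hx hy) fun i _ => hc i
  refine h2 (h.injective (funext fun i => ?_))
  let p : M →[L] N i := ⟨fun a => h a i, fun f x => congrFun (h.map_fun f x) i,
    fun r x hr => (h.map_rel r x).2 hr i⟩
  have h3 := congr_sup φ (kerCongr p) (hc' i) ((kerCongr p).toSetoid.refl (Finset.univ.sup c))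
  rwa [sup_eq_right.2 (Finset.le_sup (f := c) (Finset.mem_univ i)), top_sup_eq] at h3

theorem fsiMembers_separatedClass (hg : IsGenerator L D) :
    fsiMembers (separatedClass (L := L) D) =
      opI (opS {(⟨D, inferInstance⟩ : Bundled.{u} L.Structure)}) := by
  apply Set.Subset.antisymm
  · rintro M ⟨hs, hM⟩
    obtain ⟨_, _⟩ := Separated.exists_heytingAlgebra φ (D := D) hs
    obtain ⟨hne, hw⟩ := IsFSI.wellConnected φ hg hs hM
    obtain ⟨h, hh⟩ := exists_injective_hom φ hs hg hne hw
    exact ⟨M, ⟨_, rfl, ⟨Embedding.ofInjective hh⟩⟩, ⟨FirstOrder.Language.Equiv.refl L M⟩⟩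
  · rintro M ⟨N, ⟨_, rfl, ⟨e⟩⟩, ⟨e'⟩⟩
    let p : M →[L] D := e.toHom.comp e'.toHom
    have hp : Function.Injective p := e.injective.comp e'.injective
    have hs : Separated (L := L) D M :=
      Separated.of_injective (N := D) (fun a b hab => hab (Hom.id L D)) p hp
    obtain ⟨_, _⟩ := Separated.exists_heytingAlgebra φ (D := D) hs
    refine ⟨hs, IsFSI.of_wellConnected φ (fun h => hg.bot_ne_top ?_) fun a b hab => ?_⟩
    · rw [← hom_bot φ p, h, hom_top φ]
    · have h1 := hom_sup φ p a b
      rw [hab, hom_top φ] at h1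
      exact (hg.sup_eq_top _ _ h1.symm).imp (fun h => hp (h.trans (hom_top φ p).symm))
        fun h => hp (h.trans (hom_top φ p).symm)

end

end Generators

end ImplicitOps

namespace ImplicitOps

/-! ### Preservation of positive primitive formulas -/

section PositivePrimitive

variable {L : FirstOrder.Language.{0, 0}} {α : Type}

/-- A formula that is equivalent to a system of equations in all algebras on types in `Type u`. -/
def IsEquational (γ : L.Formula α) : Prop :=
  ∃ S : Set (L.Term α × L.Term α), ∀ (M : Type u) [L.Structure M] (v : α → M),
    γ.Realize v ↔ ∀ p ∈ S, p.1.realize v = p.2.realize v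

theorem isEquational_equal (s t : L.Term α) : IsEquational.{u} (Term.equal s t) :=
  ⟨{(s, t)}, fun M _ v => by simp [Formula.realize_equal]⟩

theorem IsEquational.inf {γ δ : L.Formula α} (hγ : IsEquational.{u} γ) (hδ : IsEquational.{u} δ) :
    IsEquational.{u} (γ ⊓ δ) := by
  obtain ⟨S, hS⟩ := hγ
  obtain ⟨T, hT⟩ := hδ
  refine ⟨S ∪ T, fun M _ v => ?_⟩
  rw [Formula.realize_inf, hS, hT]
  simp only [Set.mem_union, or_imp, forall_and]

theorem IsEquational.iInf {β : Type} [Finite β] {γ : β → L.Formula α}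
    (hγ : ∀ b, IsEquational.{u} (γ b)) : IsEquational.{u} (Formula.iInf γ) := by
  choose S hS using hγ
  refine ⟨⋃ b, S b, fun M _ v => ?_⟩
  rw [Formula.realize_iInf]
  simp only [hS, Set.mem_iUnion]
  exact ⟨fun h p ⟨b, hb⟩ => h b p hb, fun h b p hb => h p ⟨b, hb⟩⟩

theorem IsEquational.realize_hom {γ : L.Formula α} (hγ : IsEquational.{u} γ) {M N : Type u}
    [L.Structure M] [L.Structure N] (h : M →[L] N) {v : α → M} (hv : γ.Realize v) :
    γ.Realize (h ∘ v) := by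
  obtain ⟨S, hS⟩ := hγ
  rw [hS] at hv ⊢
  intro p hp
  rw [HomClass.realize_term, HomClass.realize_term, hv p hp]

theorem IsEquational.realize_of_forall_hom {γ : L.Formula α} (hγ : IsEquational.{u} γ)
    {ι : Type*} {M : Type u} [L.Structure M] {N : ι → Type u} [∀ i, L.Structure (N i)]
    (h : ∀ i, M →[L] N i) (hh : ∀ a b, (∀ i, h i a = h i b) → a = b) {v : α → M}
    (hv : ∀ i, γ.Realize (h i ∘ v)) : γ.Realize v := by
  obtain ⟨S, hS⟩ := hγ
  rw [hS]
  intro p hp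
  refine hh _ _ fun i => ?_
  rw [← HomClass.realize_term, ← HomClass.realize_term]
  exact (hS _ _).1 (hv i) p hp

end PositivePrimitive

section Phi

variable {α : Type}

theorem isEquational_psi (m n : ℕ) (x y : heytingLang.Term α)
    (z : Fin (n + 1) → heytingLang.Term α) : IsEquational.{u} (psi m n x y z) :=
  .inf (.iInf fun _ => isEquational_equal _ _)
    (.inf (isEquational_equal _ _) (isEquational_equal _ _))

theorem isEquational_gammaFormula (k n : ℕ) : IsEquational.{u} (gammaFormula k n) :=
  .inf (isEquational_equal _ _) (.iInf fun _ => isEquational_psi _ _ _ _ _)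

theorem comp_pair {M N : Type*} (h : M → N) (a b : M) : h ∘ ![a, b] = ![h a, h b] := by
  funext i
  fin_cases i <;> rfl

theorem phi_realize_hom (k n : ℕ) {M N : Type u} [heytingLang.Structure M]
    [heytingLang.Structure N] (h : M →[heytingLang] N) {a b : M}
    (hab : (phi k n).Realize ![a, b]) : (phi k n).Realize ![h a, h b] := by
  obtain ⟨v, hv⟩ := Formula.realize_iExs.1 hab
  refine Formula.realize_iExs.2 ⟨h ∘ v, ?_⟩
  rw [← comp_pair, ← Sum.comp_elim]
  exact (isEquational_gammaFormula k n).realize_hom h hv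

/-- A primitive positive formula holds in a product when it holds in all the factors. -/
theorem phi_realize_of_forall_hom (k n : ℕ) {ι : Type*} {M : Type u} [heytingLang.Structure M]
    {N : ι → Type u} [∀ i, heytingLang.Structure (N i)] (h : ∀ i, M →[heytingLang] N i)
    (hh : Function.Bijective fun a i => h i a) {a b : M}
    (hab : ∀ i, (phi k n).Realize ![h i a, h i b]) : (phi k n).Realize ![a, b] := by
  choose v hv using fun i => Formula.realize_iExs.1 (hab i)
  -- Surjectivity glues the coordinatewise witnesses into witnesses in `M`.
  choose w hw using fun j => hh.2 fun i => v i j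
  refine Formula.realize_iExs.2 ⟨w, ?_⟩
  refine (isEquational_gammaFormula k n).realize_of_forall_hom h
    (fun a b hab => hh.1 (funext hab)) fun i => ?_
  rw [Sum.comp_elim, comp_pair]
  have : h i ∘ w = v i := funext fun j => congrFun (hw j) i
  rw [this]
  exact hv i

end Phi

/-! ### The Heyting algebras `A_κ` -/

section AlgA

/-- The Heyting algebra structure of `A_κ`. -/
noncomputable instance instHeytingAlgebraAcarrier {κ : Type u} : HeytingAlgebra (Acarrier κ) :=
  HeytingAlgebra.ofHImp Aimp fun a b c => le_Aimp_iff b c a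

instance isAlgebraic_heytingLang : heytingLang.IsAlgebraic :=
  fun _ => inferInstanceAs (IsEmpty Empty)

/-- The structure on the universe of `A_κ`. -/
noncomputable instance instStructureAcarrier {κ : Type u} : heytingLang.Structure (Acarrier κ) :=
  (algA κ).str

instance heytingReduct_algA {κ : Type u} :
    HeytingReduct (LHom.id heytingLang) (Acarrier κ) where
  funMap_inf _ := rfl
  funMap_sup _ := rfl
  funMap_imp _ := rfl
  funMap_bot _ := rfl
  funMap_top _ := rfl

variable {κ : Type u}

theorem Acarrier.bot_eq : (⊥ : Acarrier κ) = ((∅ : Set κ) : Acarrier κ) := rfl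

/-- Nonemptiness matters: the pseudocomplement of `∅` is the added `⊤`, not `Set.univ`. -/
theorem Acarrier.coe_compl {X : Set κ} (hX : X.Nonempty) :
    (X : Acarrier κ)ᶜ = ((Xᶜ : Set κ) : Acarrier κ) := by
  have h : ¬ (X : Acarrier κ) ≤ ((∅ : Set κ) : Acarrier κ) := fun h =>
    hX.ne_empty (Set.subset_empty_iff.1 (WithTop.coe_le_coe.1 h))
  rw [← himp_bot]
  have h1 : (X : Acarrier κ) ⇨ ⊥ = ((Xᶜ ∪ ∅ : Set κ) : Acarrier κ) := if_neg h
  rw [h1, Set.union_empty]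

theorem Acarrier.sup_eq_top (a b : Acarrier κ) (h : a ⊔ b = ⊤) : a = ⊤ ∨ b = ⊤ := by
  induction a using WithTop.recTopCoe with
  | top => exact Or.inl rfl
  | coe s =>
    induction b using WithTop.recTopCoe with
    | top => exact Or.inr rfl
    | coe t => exact absurd h (WithTop.coe_ne_top (a := s ⊔ t))

theorem Acarrier.le_univ {a : Acarrier κ} (ha : a ≠ ⊤) :
    a ≤ ((Set.univ : Set κ) : Acarrier κ) := by
  induction a using WithTop.recTopCoe with
  | top => exact absurd rfl ha
  | coe s => exact WithTop.coe_le_coe.2 (Set.subset_univ s)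

theorem Acarrier.coe_sup_compl {X : Set κ} (hX : X.Nonempty) :
    (X : Acarrier κ) ⊔ (X : Acarrier κ)ᶜ = ((Set.univ : Set κ) : Acarrier κ) := by
  rw [Acarrier.coe_compl hX, ← WithTop.coe_sup]
  exact congrArg _ (Set.union_compl_self X)

theorem Acarrier.univ_le_sup_compl (a : Acarrier κ) :
    ((Set.univ : Set κ) : Acarrier κ) ≤ a ⊔ aᶜ := by
  induction a using WithTop.recTopCoe with
  | top => exact le_top.trans le_sup_left
  | coe X =>
    rcases X.eq_empty_or_nonempty with rfl | hX
    · rw [← Acarrier.bot_eq, compl_bot]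
      exact le_top.trans le_sup_right
    · rw [Acarrier.coe_sup_compl hX]

theorem Acarrier.depth_two (a b : Acarrier κ) : a ⊔ (a ⇨ (b ⊔ bᶜ)) = ⊤ := by
  by_cases ha : a = ⊤
  · rw [ha, top_sup_eq]
  · rw [himp_eq_top_iff.2 ((Acarrier.le_univ ha).trans (Acarrier.univ_le_sup_compl b)),
      sup_top_eq]

variable {L : FirstOrder.Language.{0, 0}}

/-- The Heyting operations respect filters. -/
theorem HeytingReduct.compat (φ : heytingLang →ᴸ L) {M : Type*} [L.Structure M] [HeytingAlgebra M]
    [hM : HeytingReduct φ M] {m : ℕ} (f : heytingLang.Functions m) (x y : Fin m → M) (a : M)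
    (h : ∀ i, a ⊓ x i = a ⊓ y i) :
    a ⊓ Structure.funMap (φ.onFunction f) x = a ⊓ Structure.funMap (φ.onFunction f) y := by
  have hi : ∀ b c b' c' : M, a ⊓ b = a ⊓ b' → a ⊓ c = a ⊓ c' → a ⊓ (b ⇨ c) ≤ b' ⇨ c' := by
    intro b c b' c' hb hc
    rw [le_himp_iff, inf_right_comm, ← hb, inf_assoc, inf_himp, ← inf_assoc, inf_right_comm, hc]
    exact inf_le_left.trans inf_le_right
  match m, f, x, y, h with
  | _, HeytingSymbol.inf, x, y, h =>
    rw [hM.funMap_inf, hM.funMap_inf, inf_inf_distrib_left, h, h, ← inf_inf_distrib_left]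
  | _, HeytingSymbol.sup, x, y, h =>
    rw [hM.funMap_sup, hM.funMap_sup, inf_sup_left, h, h, ← inf_sup_left]
  | _, HeytingSymbol.imp, x, y, h =>
    rw [hM.funMap_imp, hM.funMap_imp]
    exact le_antisymm (le_inf inf_le_left (hi _ _ _ _ (h 0) (h 1)))
      (le_inf inf_le_left (hi _ _ _ _ (h 0).symm (h 1).symm))
  | _, HeytingSymbol.bot, x, y, h => rw [hM.funMap_bot, hM.funMap_bot]
  | _, HeytingSymbol.top, x, y, h => rw [hM.funMap_top, hM.funMap_top]

/-- The Heyting operations preserve `{⊥, ⊤}`. -/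
theorem HeytingReduct.two (φ : heytingLang →ᴸ L) {M : Type*} [L.Structure M] [HeytingAlgebra M]
    [hM : HeytingReduct φ M] {m : ℕ} (f : heytingLang.Functions m) (x : Fin m → M)
    (h : ∀ i, x i = ⊥ ∨ x i = ⊤) :
    Structure.funMap (φ.onFunction f) x = ⊥ ∨ Structure.funMap (φ.onFunction f) x = ⊤ := by
  match m, f, x, h with
  | _, HeytingSymbol.inf, x, h =>
    rw [hM.funMap_inf]
    rcases h 0 with h0 | h0 <;> rcases h 1 with h1 | h1 <;> simp [h0, h1]
  | _, HeytingSymbol.sup, x, h =>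
    rw [hM.funMap_sup]
    rcases h 0 with h0 | h0 <;> rcases h 1 with h1 | h1 <;> simp [h0, h1]
  | _, HeytingSymbol.imp, x, h =>
    rw [hM.funMap_imp]
    rcases h 0 with h0 | h0 <;> rcases h 1 with h1 | h1 <;> simp [h0, h1]
  | _, HeytingSymbol.bot, x, h => exact Or.inl (hM.funMap_bot x)
  | _, HeytingSymbol.top, x, h => exact Or.inr (hM.funMap_top x)

theorem isGenerator_algA [Finite κ] : IsGenerator heytingLang (Acarrier κ) where
  finite := inferInstanceAs (Finite (Option (Set κ)))
  bot_ne_top := WithTop.coe_ne_top (a := (∅ : Set κ))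
  sup_eq_top := Acarrier.sup_eq_top
  depth_two := Acarrier.depth_two
  compat := HeytingReduct.compat (LHom.id heytingLang)
  two := HeytingReduct.two (LHom.id heytingLang)

end AlgA

/-! ### Interpretation of the formulas in `A_κ` -/

section Realize

variable {α : Type} {κ : Type u} (v : α → Acarrier κ)

theorem realize_tInf (s t : heytingLang.Term α) :
    (tInf s t).realize v = s.realize v ⊓ t.realize v := rfl

theorem realize_tSup (s t : heytingLang.Term α) :
    (tSup s t).realize v = s.realize v ⊔ t.realize v := rfl

theorem realize_tImp (s t : heytingLang.Term α) :
    (tImp s t).realize v = s.realize v ⇨ t.realize v := rfl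

theorem realize_tBot : (tBot : heytingLang.Term α).realize v = ⊥ := rfl

theorem realize_tTop : (tTop : heytingLang.Term α).realize v = ⊤ := rfl

theorem realize_tNeg (t : heytingLang.Term α) : (tNeg t).realize v = (t.realize v)ᶜ := by
  rw [tNeg, realize_tImp, realize_tBot, himp_bot]

theorem realize_tD (t : heytingLang.Term α) :
    (tD t).realize v = t.realize v ⊔ (t.realize v)ᶜ := by
  rw [tD, realize_tSup, realize_tNeg]

theorem realize_tBigSup_finRange {N : ℕ} (z : Fin N → heytingLang.Term α) :
    (tBigSup ((List.finRange N).map z)).realize v = Finset.univ.sup fun i => (z i).realize v := by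
  have h : ∀ l : List (heytingLang.Term α), ∀ b,
      (tBigSup l).realize v ≤ b ↔ ∀ t ∈ l, t.realize v ≤ b := by
    intro l b
    induction l with
    | nil => simp [tBigSup, realize_tBot]
    | cons t l ih =>
      rw [List.forall_mem_cons, ← ih]
      exact sup_le_iff
  refine eq_of_forall_ge_iff fun b => ?_
  rw [h, Finset.sup_le_iff]
  simp

theorem realize_tBigInf_eq_top (l : List (heytingLang.Term α)) :
    (tBigInf l).realize v = ⊤ ↔ ∀ t ∈ l, t.realize v = ⊤ := by
  induction l with
  | nil => simp [tBigInf, realize_tTop]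
  | cons t l ih =>
    rw [List.forall_mem_cons, ← ih]
    exact inf_eq_top_iff

theorem realize_tDisjoint_eq_top {N : ℕ} (z : Fin N → heytingLang.Term α) (lo hi : ℕ) :
    (tDisjoint z lo hi).realize v = ⊤ ↔ ∀ i j : Fin N, i ≠ j →
      (lo ≤ i.val + 1 ∧ i.val + 1 ≤ hi) → (lo ≤ j.val + 1 ∧ j.val + 1 ≤ hi) →
        Disjoint ((z i).realize v) ((z j).realize v) := by
  rw [tDisjoint, realize_tBigInf_eq_top]
  simp only [List.mem_map, List.mem_filter, decide_eq_true_eq, forall_exists_index, and_imp,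
    Prod.forall]
  have e : ∀ i j : Fin N, (tNeg (tInf (z i) (z j))).realize v = ⊤ ↔
      Disjoint ((z i).realize v) ((z j).realize v) := fun i j => by
    rw [realize_tNeg, realize_tInf, ← himp_bot, himp_eq_top_iff, disjoint_iff_inf_le]
  constructor
  · intro h i j hij h1 h2 h3 h4
    exact (e i j).1 (h _ i j (List.mem_product.2 ⟨List.mem_finRange i, List.mem_finRange j⟩)
      hij h1 h2 h3 h4 rfl)
  · rintro h _ i j - hij h1 h2 h3 h4 rfl
    exact (e i j).2 (h i j hij h1 h2 h3 h4)

/-- The interpretation of `ψ_{m,n}` in `A_κ`. -/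
def PsiHolds (m n : ℕ) (x y : Acarrier κ) (z : Fin (n + 1) → Acarrier κ) : Prop :=
  (∀ i, x ⊔ xᶜ = z i ⊔ (z i)ᶜ) ∧ (x ⊔ xᶜ) ⊔ (x ⊔ Finset.univ.sup z)ᶜᶜ = y ∧
    (((∀ i, z i ≤ x) ∧ ∀ i j, i ≠ j → i.val ≤ m → j.val ≤ m → Disjoint (z i) (z j)) ∨
      ((∀ i, z i ≤ xᶜ) ∧ ∀ i j, i ≠ j → m < i.val → m < j.val → Disjoint (z i) (z j)))

theorem realize_psi (m n : ℕ) (x y : heytingLang.Term α) (z : Fin (n + 1) → heytingLang.Term α) :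
    (psi m n x y z).Realize v ↔
      PsiHolds m n (x.realize v) (y.realize v) fun i => (z i).realize v := by
  -- Join-primeness of `⊤` turns the third equation of `psi` into a genuine disjunction.
  have top_iff : ∀ a b : Acarrier κ, a ⊔ b = ⊤ ↔ a = ⊤ ∨ b = ⊤ := fun a b =>
    ⟨Acarrier.sup_eq_top a b, by rintro (rfl | rfl) <;> simp⟩
  simp only [psi, Formula.realize_inf, Formula.realize_iInf, Formula.realize_equal, realize_tD,
    realize_tSup, realize_tNeg, realize_tInf, realize_tImp, realize_tTop,
    realize_tBigSup_finRange, top_iff, inf_eq_top_iff, himp_eq_top_iff, Finset.sup_le_iff,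
    realize_tDisjoint_eq_top, PsiHolds, Finset.mem_univ, true_imp_iff]
  have e1 : ∀ i : Fin (n + 1), (1 ≤ i.val + 1 ∧ i.val + 1 ≤ m + 1) ↔ i.val ≤ m := by omega
  have e2 : ∀ i : Fin (n + 1), (m + 2 ≤ i.val + 1 ∧ i.val + 1 ≤ n + 1) ↔ m < i.val := by omega
  simp only [e1, e2]

theorem realize_phi (k n : ℕ) (x y : Acarrier κ) :
    (phi k n).Realize ![x, y] ↔ ∃ w : Fin k → Acarrier κ, y = Finset.univ.sup w ∧
      ∀ m, ∃ z, PsiHolds (m.val + 1) n x (w m) z := by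
  rw [phi, Formula.realize_iExs]
  simp only [gammaFormula, Formula.realize_inf, Formula.realize_iInf, Formula.realize_equal,
    realize_psi, realize_tBigSup_finRange, Term.realize_var, Sum.elim_inl, Sum.elim_inr]
  constructor
  · rintro ⟨i, h1, h2⟩
    exact ⟨fun m => i (Sum.inr m), h1, fun m => ⟨_, h2 m⟩⟩
  · rintro ⟨w, h1, h2⟩
    choose z hz using h2
    exact ⟨Sum.elim (fun p => z p.1 p.2) w, h1, hz⟩

end Realize

end ImplicitOps

namespace ImplicitOps

/-! ### Counting disjoint nonempty sets -/

section Counting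

variable {κ : Type u} {n : ℕ}

theorem ncard_val_le {m : ℕ} (hm : m ≤ n) : {i : Fin (n + 1) | i.val ≤ m}.ncard = m + 1 := by
  have : {i : Fin (n + 1) | i.val ≤ m} =
      (Finset.Iic (⟨m, Nat.lt_succ_of_le hm⟩ : Fin (n + 1)) : Set (Fin (n + 1))) := by
    ext i
    simp [Fin.le_def]
  rw [this, Set.ncard_coe_finset, Fin.card_Iic]

theorem ncard_lt_val {m : ℕ} (hm : m ≤ n) : {i : Fin (n + 1) | m < i.val}.ncard = n - m := by
  have : {i : Fin (n + 1) | m < i.val} =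
      (Finset.Ioi (⟨m, Nat.lt_succ_of_le hm⟩ : Fin (n + 1)) : Set (Fin (n + 1))) := by
    ext i
    simp [Fin.lt_def]
  rw [this, Set.ncard_coe_finset, Fin.card_Ioi]
  simp

/-- A set containing the members of a disjoint family of nonempty sets has at least as many elements
as the family, and is covered by it if it has just as many. -/
theorem ncard_le_of_pairwise_disjoint [Finite κ] {ι : Type*} {S : Set ι} {T : Set κ}
    {Z : ι → Set κ} (hne : ∀ i, (Z i).Nonempty) (hT : ∀ i, Z i ⊆ T)
    (hd : ∀ i ∈ S, ∀ j ∈ S, i ≠ j → Disjoint (Z i) (Z j)) :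
    S.ncard ≤ T.ncard ∧ (T.ncard ≤ S.ncard → ∀ a ∈ T, ∃ i, a ∈ Z i) := by
  choose c hc using hne
  have hinj : Set.InjOn c S := fun i hi j hj hij => by
    by_contra hne
    exact Set.disjoint_left.1 (hd i hi j hj hne) (hc i) (hij ▸ hc j)
  have hsub : c '' S ⊆ T := by
    rintro _ ⟨i, _, rfl⟩
    exact hT i (hc i)
  have hcard := hinj.ncard_image
  refine ⟨hcard ▸ Set.ncard_le_ncard hsub (Set.toFinite T), fun hle a ha => ?_⟩
  rw [← Set.eq_of_subset_of_ncard_le hsub (hcard ▸ hle) (Set.toFinite T)] at ha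
  obtain ⟨i, _, rfl⟩ := ha
  exact ⟨i, hc i⟩

/-- Supplies singletons for the `z i`: only the indices in `S` must be disjoint, and the rest share
a default point of `T`. -/
theorem exists_injOn_mapsTo {ι : Type*} [Finite ι] [Finite κ] {S : Set ι} {T : Set κ}
    (hT : T.Nonempty) (h : S.ncard ≤ T.ncard) :
    ∃ c : ι → κ, (∀ i, c i ∈ T) ∧ Set.InjOn c S := by
  classical
  obtain ⟨a, ha⟩ := hT
  have : Nonempty κ := ⟨a⟩
  obtain ⟨c, hc, hi⟩ := (Set.toFinite S).exists_injOn_of_encard_le (t := T) (by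
    rw [← (Set.toFinite S).cast_ncard_eq, ← (Set.toFinite T).cast_ncard_eq]
    exact_mod_cast h)
  refine ⟨fun i => if i ∈ S then c i else a, fun i => ?_, fun i hs j ht hij => ?_⟩
  · by_cases hs : i ∈ S
    · simp only [if_pos hs]
      exact hc hs
    · simpa only [if_neg hs]
  · simp only [if_pos hs, if_pos ht] at hij
    exact hi hs ht hij

end Counting

/-! ### Functionality and totality of the implicit operations -/

section Psi

variable {κ : Type u} {m n k : ℕ} {x y : Acarrier κ} {X : Set κ} {z : Fin (n + 1) → Acarrier κ}

theorem PsiHolds.univ_le (h : PsiHolds m n x y z) :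
    ((Set.univ : Set κ) : Acarrier κ) ≤ y := by
  rw [← h.2.1]
  exact (Acarrier.univ_le_sup_compl x).trans le_sup_left

theorem PsiHolds.eq_top_of_sup_compl (h : PsiHolds m n x y z) (hx : x ⊔ xᶜ = ⊤) : y = ⊤ := by
  rw [← h.2.1, hx, top_sup_eq]

/-- Here `d(x)` is the coatom, while `d` takes the value `⊤` at both `⊤` and `∅`; so the equations
`d(x) ≈ d(z_i)` exclude these two. -/
theorem PsiHolds.exists_coe (h : PsiHolds m n X y z) (hX : X.Nonempty) :
    ∃ Z : Fin (n + 1) → Set κ, (∀ i, (Z i).Nonempty) ∧ ∀ i, z i = Z i := by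
  have h1 : ∀ i, ∃ Z : Set κ, Z.Nonempty ∧ z i = Z := by
    intro i
    have h2 := h.1 i
    rw [Acarrier.coe_sup_compl hX] at h2
    generalize z i = c at h2
    induction c using WithTop.recTopCoe with
    | top =>
      rw [top_sup_eq] at h2
      exact absurd h2 WithTop.coe_ne_top
    | coe Z =>
      refine ⟨Z, Set.nonempty_iff_ne_empty.2 ?_, rfl⟩
      rintro rfl
      rw [← Acarrier.bot_eq, compl_bot, sup_top_eq] at h2
      exact absurd h2 WithTop.coe_ne_top
  choose Z hZ using h1
  exact ⟨Z, fun i => (hZ i).1, fun i => (hZ i).2⟩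

theorem Acarrier.disjoint_coe {Y Z : Set κ} :
    Disjoint (Y : Acarrier κ) (Z : Acarrier κ) ↔ Disjoint Y Z := by
  rw [disjoint_iff_inf_le, disjoint_iff_inf_le, ← WithTop.coe_inf, Acarrier.bot_eq,
    WithTop.coe_le_coe]
  rfl

theorem Acarrier.compl_compl_univ [Nonempty κ] :
    ((Set.univ : Set κ) : Acarrier κ)ᶜᶜ = ⊤ := by
  rw [Acarrier.coe_compl Set.univ_nonempty, Set.compl_univ, ← Acarrier.bot_eq, compl_bot]

theorem PsiHolds.eq_top_of_univ_le (h : PsiHolds m n X y z) (hX : X.Nonempty)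
    (hu : ((Set.univ : Set κ) : Acarrier κ) ≤ (X : Acarrier κ) ⊔ Finset.univ.sup z) : y = ⊤ := by
  have : Nonempty κ := ⟨hX.some⟩
  rw [← h.2.1]
  refine top_unique ((le_of_eq Acarrier.compl_compl_univ.symm).trans ?_)
  exact (compl_le_compl (compl_le_compl hu)).trans le_sup_right

/-- The complement of `X` has fewer than `n - m` points, too few for the second disjunct. The first
gives `s ≤ X`, and `X` is regular, so nothing is added to `d(x)`. -/
theorem PsiHolds.eq_univ_of_lt [Finite κ] (hκ : Nat.card κ = n) (h : PsiHolds m n X y z)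
    (hX : X.Nonempty) (hm : m < X.ncard) (hne : X ≠ Set.univ) :
    y = ((Set.univ : Set κ) : Acarrier κ) := by
  obtain ⟨Z, hZ, hzZ⟩ := h.exists_coe hX
  obtain ⟨-, hy, h3⟩ := h
  simp only [hzZ, Acarrier.coe_compl hX, Acarrier.disjoint_coe, WithTop.coe_le_coe] at h3
  have hXc : Xᶜ.Nonempty := Set.nonempty_compl.2 hne
  have hcard := Set.ncard_add_ncard_compl X
  rcases h3 with ⟨h4, -⟩ | ⟨h4, h5⟩
  · have h6 : Finset.univ.sup z ≤ X := Finset.sup_le fun i _ => by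
      rw [hzZ]
      exact WithTop.coe_le_coe.2 (h4 i)
    rw [sup_eq_left.2 h6, Acarrier.coe_sup_compl hX, Acarrier.coe_compl hX,
      Acarrier.coe_compl hXc, compl_compl, sup_eq_left.2] at hy
    · exact hy.symm
    · exact WithTop.coe_le_coe.2 (Set.subset_univ X)
  · have h6 := (ncard_le_of_pairwise_disjoint (S := {i : Fin (n + 1) | m < i.val}) hZ h4
      fun i hi j hj hij => h5 i j hij hi hj).1
    rw [ncard_lt_val (by omega)] at h6
    omega

/-- The set `X` cannot hold `m + 1` disjoint nonempty sets, so the second disjunct holds. Its `n -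
m` disjoint sets exhaust the `n - m` points outside `X`; hence `X ∪ s` is dense. -/
theorem PsiHolds.eq_top_of_ncard_eq [Finite κ] (hκ : Nat.card κ = n) (h : PsiHolds m n X y z)
    (hX : X.Nonempty) (hm : X.ncard = m) : y = ⊤ := by
  obtain ⟨Z, hZ, hzZ⟩ := h.exists_coe hX
  refine h.eq_top_of_univ_le hX ?_
  obtain ⟨-, hy, h3⟩ := h
  simp only [hzZ, Acarrier.coe_compl hX, Acarrier.disjoint_coe, WithTop.coe_le_coe] at h3
  have hcard := Set.ncard_add_ncard_compl X
  rcases h3 with ⟨h4, h5⟩ | ⟨h4, h5⟩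
  · have h6 := (ncard_le_of_pairwise_disjoint (S := {i : Fin (n + 1) | i.val ≤ m}) hZ h4
      fun i hi j hj hij => h5 i j hij hi hj).1
    rw [ncard_val_le (by omega)] at h6
    omega
  · have h6 := (ncard_le_of_pairwise_disjoint (S := {i : Fin (n + 1) | m < i.val}) hZ h4
      fun i hi j hj hij => h5 i j hij hi hj).2
    rw [ncard_lt_val (by omega)] at h6
    specialize h6 (by omega)
    generalize hs : Finset.univ.sup z = s
    induction s using WithTop.recTopCoe with
    | top => exact le_top.trans le_sup_right
    | coe s =>
      rw [← WithTop.coe_sup, WithTop.coe_le_coe]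
      intro a _
      by_cases ha : a ∈ X
      · exact Or.inl ha
      · obtain ⟨i, hi⟩ := h6 a ha
        have h7 : z i ≤ Finset.univ.sup z := Finset.le_sup (Finset.mem_univ i)
        rw [hs, hzZ, WithTop.coe_le_coe] at h7
        exact Or.inr (h7 hi)

/-- The values of `y` in `ψ_{m,n}(x, y, z)` for `m ≤ k` either include a forced `⊤`, or are all
equal. -/
theorem PsiHolds.eq_top_or_eq [Finite κ] (hκ : Nat.card κ = n) (hk : 1 ≤ k) (x : Acarrier κ) :
    (∃ m : Fin k, ∀ y z, PsiHolds (m.val + 1) n x y z → y = ⊤) ∨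
      ∃ c, ∀ (m : Fin k) y z, PsiHolds (m.val + 1) n x y z → y = c := by
  by_cases hx : x ⊔ xᶜ = ⊤
  · exact Or.inl ⟨⟨0, hk⟩, fun y z h => h.eq_top_of_sup_compl hx⟩
  · induction x using WithTop.recTopCoe with
    | top => simp at hx
    | coe X =>
      have hX : X.Nonempty := by
        rw [Set.nonempty_iff_ne_empty]
        rintro rfl
        rw [← Acarrier.bot_eq, compl_bot, sup_top_eq] at hx
        exact hx rfl
      have hpos := (Set.ncard_pos (Set.toFinite X)).2 hX
      by_cases hu : X = Set.univ
      · subst hu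
        exact Or.inl ⟨⟨0, hk⟩, fun y z h => h.eq_top_of_univ_le hX le_sup_left⟩
      -- For `m > |X|` the sets `z i` may or may not cover the complement, so a single `ψ` need not
      -- determine `y`. The join over all `m ≤ k` contains the term `m = |X|`, which forces `⊤`.
      · by_cases hc : X.ncard ≤ k
        · exact Or.inl ⟨⟨X.ncard - 1, by omega⟩, fun y z h =>
            h.eq_top_of_ncard_eq hκ hX (by change _ = X.ncard - 1 + 1; omega)⟩
        · exact Or.inr ⟨_, fun m y z h => h.eq_univ_of_lt hκ hX (by omega) hu⟩

/-- Either `X` has `m + 1` points or its complement has `n - m`; distinct singletons there satisfy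
the matching disjunct. -/
theorem exists_psiHolds [Finite κ] (hκ : Nat.card κ = n) (hm : m < n) (x : Acarrier κ) :
    ∃ y z, PsiHolds m n x y z := by
  suffices h : ∃ z, PsiHolds m n x ((x ⊔ xᶜ) ⊔ (x ⊔ Finset.univ.sup z)ᶜᶜ) z by
    obtain ⟨z, hz⟩ := h
    exact ⟨_, z, hz⟩
  by_cases hx : x ⊔ xᶜ = ⊤
  · exact ⟨fun _ => ⊥, fun i => by rw [hx, compl_bot, sup_top_eq], rfl,
      Or.inl ⟨fun i => bot_le, fun i j _ _ _ => disjoint_bot_left⟩⟩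
  · induction x using WithTop.recTopCoe with
    | top => simp at hx
    | coe X =>
      have hX : X.Nonempty := by
        rw [Set.nonempty_iff_ne_empty]
        rintro rfl
        rw [← Acarrier.bot_eq, compl_bot, sup_top_eq] at hx
        exact hx rfl
      have hcard := Set.ncard_add_ncard_compl X
      by_cases hc : m < X.ncard
      · obtain ⟨c, hcX, hinj⟩ := exists_injOn_mapsTo (S := {i : Fin (n + 1) | i.val ≤ m}) hX
          (by rw [ncard_val_le hm.le]; exact hc)
        refine ⟨fun i => (({c i} : Set κ) : Acarrier κ), fun i => ?_, rfl, Or.inl ⟨fun i =>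
          WithTop.coe_le_coe.2 (Set.singleton_subset_iff.2 (hcX i)), fun i j hij hi hj => ?_⟩⟩
        · rw [Acarrier.coe_sup_compl hX, Acarrier.coe_sup_compl (Set.singleton_nonempty _)]
        · rw [Acarrier.disjoint_coe, Set.disjoint_singleton]
          exact fun h => hij (hinj hi hj h)
      · have hXc : Xᶜ.Nonempty := (Set.ncard_pos (Set.toFinite _)).1 (by omega)
        obtain ⟨c, hcX, hinj⟩ := exists_injOn_mapsTo (S := {i : Fin (n + 1) | m < i.val}) hXc
          (by rw [ncard_lt_val hm.le]; omega)
        refine ⟨fun i => (({c i} : Set κ) : Acarrier κ), fun i => ?_, rfl, Or.inr ⟨fun i => ?_,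
          fun i j hij hi hj => ?_⟩⟩
        · rw [Acarrier.coe_sup_compl hX, Acarrier.coe_sup_compl (Set.singleton_nonempty _)]
        · rw [Acarrier.coe_compl hX]
          exact WithTop.coe_le_coe.2 (Set.singleton_subset_iff.2 (hcX i))
        · rw [Acarrier.disjoint_coe, Set.disjoint_singleton]
          exact fun h => hij (hinj hi hj h)

theorem phi_functional [Finite κ] (hκ : Nat.card κ = n) (hk : 1 ≤ k) {x y y' : Acarrier κ}
    (h : (phi k n).Realize ![x, y]) (h' : (phi k n).Realize ![x, y']) : y = y' := by
  rw [realize_phi] at h h'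
  obtain ⟨w, rfl, hw⟩ := h
  obtain ⟨w', rfl, hw'⟩ := h'
  choose z hz using hw
  choose z' hz' using hw'
  rcases PsiHolds.eq_top_or_eq hκ hk x with ⟨m, hm⟩ | ⟨c, hc⟩
  · have e : ∀ v : Fin k → Acarrier κ, v m = ⊤ → Finset.univ.sup v = ⊤ := fun v hv =>
      top_unique (hv ▸ Finset.le_sup (Finset.mem_univ m))
    rw [e w (hm _ _ (hz m)), e w' (hm _ _ (hz' m))]
  · exact congrArg _ (funext fun m => (hc m _ _ (hz m)).trans (hc m _ _ (hz' m)).symm)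

theorem phi_total [Finite κ] (hκ : Nat.card κ = n) (hkn : k < n) (x : Acarrier κ) :
    ∃ y, (phi k n).Realize ![x, y] := by
  choose w z hz using fun m : Fin k => exists_psiHolds hκ (m := m.val + 1) (by omega) x
  exact ⟨_, (realize_phi k n x _).2 ⟨w, rfl, fun m => ⟨z m, hz m⟩⟩⟩

theorem univ_le_of_realize_phi (hk : 1 ≤ k) (h : (phi k n).Realize ![x, y]) :
    ((Set.univ : Set κ) : Acarrier κ) ≤ y := by
  obtain ⟨w, rfl, hw⟩ := (realize_phi k n x y).1 h
  obtain ⟨z, hz⟩ := hw ⟨0, hk⟩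
  exact hz.univ_le.trans (Finset.le_sup (Finset.mem_univ _))

theorem eq_top_of_realize_phi (hk : 1 ≤ k) (hx : x ⊔ xᶜ = ⊤) (h : (phi k n).Realize ![x, y]) :
    y = ⊤ := by
  obtain ⟨w, rfl, hw⟩ := (realize_phi k n x y).1 h
  obtain ⟨z, hz⟩ := hw ⟨0, hk⟩
  exact top_unique ((hz.eq_top_of_sup_compl hx).ge.trans (Finset.le_sup (Finset.mem_univ _)))

end Psi

/-! ### The algebra `B_n` and the class `B(n)` -/

section AlgB

variable (n : ℕ)

theorem card_ulift_fin : Nat.card (ULift.{u} (Fin n)) = n := by simp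

instance isAlgebraic_langB : (langB n).IsAlgebraic :=
  fun _ => inferInstanceAs (IsEmpty (Empty ⊕ Empty))

/-- The structure on the universe of `B_n`. -/
noncomputable instance instStructureAlgB : (langB n).Structure (Acarrier (ULift.{u} (Fin n))) :=
  (algB n).str

instance heytingReduct_algB : HeytingReduct (LHom.sumInl : heytingLang →ᴸ langB n)
    (Acarrier (ULift.{u} (Fin n))) where
  funMap_inf _ := rfl
  funMap_sup _ := rfl
  funMap_imp _ := rfl
  funMap_bot _ := rfl
  funMap_top _ := rfl

variable {n}

theorem opIndex_lt (k : OpIndex n) : k.val < n := by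
  have := k.2
  omega

theorem realize_phiFamily_funMap (k : OpIndex n) (x : Fin 1 → Acarrier (ULift.{u} (Fin n))) :
    (phiFamily n k).Realize ![x 0, Structure.funMap (newSymbol (L := heytingLang) k) x] := by
  have h : ∃ b, (phiFamily n k).Realize ![x 0, b] :=
    phi_total (card_ulift_fin n) (opIndex_lt k) (x 0)
  have e : Structure.funMap (newSymbol (L := heytingLang) k) x = h.choose := dif_pos h
  rw [e]
  exact h.choose_spec

theorem isGenerator_algB :
    IsGenerator (langB n) (Acarrier (ULift.{u} (Fin n))) where
  finite := isGenerator_algA.finite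
  bot_ne_top := isGenerator_algA.bot_ne_top
  sup_eq_top := Acarrier.sup_eq_top
  depth_two := Acarrier.depth_two
  compat := by
    rintro m (f | ⟨⟨k⟩⟩) x y a h
    · exact HeytingReduct.compat (LHom.sumInl : heytingLang →ᴸ langB n) f x y a h
    · by_cases ha : a = ⊤
      · subst ha
        simp only [top_inf_eq] at h
        rw [funext h]
      -- Values of the new operations lie above the coatom, hence above every `a ≠ ⊤`, and meeting
      -- with `a` erases them.
      · have h1 : ∀ v : Fin 1 → Acarrier (ULift.{u} (Fin n)),
            a ⊓ Structure.funMap (newSymbol (L := heytingLang) k) v = a := fun v =>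
          inf_eq_left.2 ((Acarrier.le_univ ha).trans
            (univ_le_of_realize_phi k.2.1 (realize_phiFamily_funMap k v)))
        exact (h1 x).trans (h1 y).symm
  two := by
    rintro m (f | ⟨⟨k⟩⟩) x h
    · exact HeytingReduct.two (LHom.sumInl : heytingLang →ᴸ langB n) f x h
    · refine Or.inr (eq_top_of_realize_phi k.2.1 ?_ (realize_phiFamily_funMap k x))
      rcases h 0 with h0 | h0 <;> rw [h0] <;> simp

theorem varA_eq : varA.{u} n =
    separatedClass (L := heytingLang) (Acarrier (ULift.{u} (Fin n))) :=
  varietyGen_eq_separatedClass (D := Acarrier (ULift.{u} (Fin n))) (LHom.id heytingLang)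
    isGenerator_algA

/-- Two values at `a` have the same image under every homomorphism to `A_n`, where the formula is
functional, and these homomorphisms separate points. -/
theorem isFunctional_phiFamily (k : OpIndex n) :
    IsFunctional (varA.{u} n) (phiFamily n k) := by
  intro M hM a b c hb hc
  rw [varA_eq] at hM
  exact hM b c fun h => phi_functional (card_ulift_fin n) k.2.1 (phi_realize_hom _ _ h hb)
    (phi_realize_hom _ _ h hc)

theorem isTotalOn_phiFamily (k : OpIndex n) :
    IsTotalOn (algAn.{u} n) (phiFamily n k) :=
  phi_total (card_ulift_fin n) (opIndex_lt k)

/-- A homomorphism between the reducts of `M` and `B_n` preserves the new operations. -/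
noncomputable def expHom {M : Bundled.{u} (langB n).Structure}
    (hM : ∀ (k : OpIndex n) (a b : reduct M),
      Structure.funMap (M := M) (newSymbol (L := heytingLang) k) ![a] = b ↔
        (phiFamily n k).Realize ![a, b])
    (h : reduct M →[heytingLang] Acarrier (ULift.{u} (Fin n))) :
    M →[langB n] Acarrier (ULift.{u} (Fin n)) where
  toFun := h
  map_fun' := by
    rintro m (f | ⟨⟨k⟩⟩) x
    · exact h.map_fun f x
    · have h1 := phi_realize_hom _ _ h ((hM k (x 0) _).1 rfl)
      have h2 := realize_phiFamily_funMap k (h ∘ x)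
      have h3 := phi_functional (card_ulift_fin n) k.2.1 h1 h2
      have e : ![x 0] = x := funext fun i => by rw [Subsingleton.elim i 0]; rfl
      rw [e] at h3
      exact h3
  map_rel' r := isEmptyElim r

theorem power_mem_expClass (ι : Type u) :
    (⟨ι → Acarrier (ULift.{u} (Fin n)), inferInstance⟩ : Bundled.{u} (langB n).Structure) ∈
      expClass (varA.{u} n) (phiFamily n) := by
  let M : Bundled.{u} (langB n).Structure := ⟨ι → Acarrier (ULift.{u} (Fin n)), inferInstance⟩
  let p : ∀ _ : ι, reduct M →[heytingLang] Acarrier (ULift.{u} (Fin n)) := fun i =>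
    ⟨fun a => a i, fun _ _ => rfl, fun r => isEmptyElim r⟩
  have hval : ∀ (k : OpIndex n) (a : reduct M) (i : ι), (phiFamily n k).Realize
      ![p i a, p i (Structure.funMap (M := M) (newSymbol (L := heytingLang) k) ![a])] :=
    fun k a i => realize_phiFamily_funMap k fun j => (![a] : Fin 1 → M) j i
  refine ⟨?_, fun k a b => ⟨?_, fun hab => ?_⟩⟩
  · rw [varA_eq]
    exact fun a b hab => funext fun i => hab (p i)
  · rintro rfl
    exact phi_realize_of_forall_hom _ _ p Function.bijective_id (hval k a)
  · exact funext fun i => phi_functional (card_ulift_fin n) k.2.1 (hval k a i)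
      (phi_realize_hom _ _ (p i) hab)

/-- For one inclusion, Heyting homomorphisms from an expansion to `A_n` lift by `expHom`; for the
other, a separated algebra embeds into a power of `B_n`, which is itself an expansion of the
required kind. -/
theorem classB_eq : classB.{u} n =
    separatedClass (L := langB n) (Acarrier (ULift.{u} (Fin n))) := by
  apply Set.Subset.antisymm
  · rintro M ⟨N, ⟨hN, hN'⟩, ⟨e⟩⟩
    rw [varA_eq] at hN
    exact Separated.of_injective (N := N)
      (fun a b hab => hN a b fun h => hab (expHom hN' h)) e.toHom e.injective
  · intro M hM
    exact ⟨_, power_mem_expClass _, exists_embedding_power hM⟩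

end AlgB

end ImplicitOps

theorem mainTheorem6 (n : ℕ) (hn : 3 ≤ n) :
    (∀ k : ImplicitOps.OpIndex n,
      ImplicitOps.IsFunctional (ImplicitOps.varA.{u} n) (ImplicitOps.phiFamily n k) ∧
      ImplicitOps.IsTotalOn (ImplicitOps.algAn.{u} n) (ImplicitOps.phiFamily n k)) ∧
    ImplicitOps.classB.{u} n = ImplicitOps.varietyGen {ImplicitOps.algB.{u} n} ∧
    ImplicitOps.fsiMembers (ImplicitOps.classB.{u} n) =
      ImplicitOps.opI (ImplicitOps.opS {ImplicitOps.algB.{u} n}) ∧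
    ImplicitOps.IsArithmeticalVariety (ImplicitOps.classB.{u} n) := by
  let φ : ImplicitOps.heytingLang →ᴸ ImplicitOps.langB n := LHom.sumInl
  have hg := ImplicitOps.isGenerator_algB.{u} (n := n)
  rw [ImplicitOps.classB_eq]
  exact ⟨fun k => ⟨ImplicitOps.isFunctional_phiFamily k, ImplicitOps.isTotalOn_phiFamily k⟩,
    (ImplicitOps.varietyGen_eq_separatedClass (D := ImplicitOps.Acarrier (ULift.{u} (Fin n))) φ hg).symm,
    ImplicitOps.fsiMembers_separatedClass (D := ImplicitOps.Acarrier (ULift.{u} (Fin n))) φ hg,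
    ImplicitOps.isArithmeticalVariety_separatedClass φ hg⟩
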